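/- **Setting.** Let $V$ be an $n$-dimensional real vector space. A *polytope* $P\subset V$ is a compact set with non-empty interior that is an intersection of finitely many half spaces; a *face* is the intersection of $P$ with the bounding hyperplane of a half space containing $P$, a *facet* is a non-empty face of codimension one, and $P$ is *simple* if exactly $n$ facets pass through each vertex. A *flat measure* on $P$ (on a facet) is the restriction to it of a translation invariant measure on $V$ (on the affine span of the facet), finite on compact sets and positive on non-empty open sets; a flat measure on $\partial P$ is a measure carried by $\partial P$ whose restriction to each facet is flat. A *system* $\mathcal P=(P,d\mu,d\sigma)$ consists of a simple polytope $P$, a flat measure $d\mu$ on $P$ and a flat measure $d\sigma$ on $\partial P$. The *composite* of two systems is $$\mathcal P_1\times\mathcal P_2=(P_1\times P_2,\ d\mu_1\times d\mu_2,\ d\sigma_1\times d\mu_2+d\mu_1\times d\sigma_2).$$ A *state* of $\mathcal P$ is a lower semicontinuous function $u:P\to(0,\infty]$ that is log convex, i.e. $u((1-t)x+ty)\le u(x)^{1-t}u(y)^t$ for $x,y\in P$, $t\in[0,1]$, with $\int_P u\,d\mu=\int_P d\mu$. Its entropy and internal energy are $$S_{\mathcal P}(u)=-\frac{1}{\int_P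 d\mu}\int_P u\log u\,d\mu\in[-\infty,0],\qquad U_{\mathcal P}(u)=\frac{1}{\int_P d\mu}\int_{\partial P}u\,d\sigma\in(0,\infty].$$ An *equilibrium* of internal energy $U$ is a state $u$ with $U_{\mathcal P}(u)=U$ that maximizes $S_{\mathcal P}$ among all states of internal energy $U$. Put $\mathfrak U^*_{\mathcal P}=[\min U_{\mathcal P},U_{\mathcal P}(1_P))$, where the minimum is over all states and $1_P$ is the constant state $1$. The system is *K-unstable* if there is a convex function $q$ on $P$, integrable with respect to $d\mu$ and $d\sigma$, with $$\mathrm{DF}(q)=\frac{2\pi}{\int_P d\mu}\Big(\int_{\partial P}q\,d\sigma-\frac{\int_{\partial P}d\sigma}{\int_P d\mu}\int_P q\,d\mu\Big)<0.$$ For $U\in\mathbb R$ let $S^{\mathrm{eq}}_{\mathcal P}(U)\in[-\infty,0]$ be the supremum of $S_{\mathcal P}(u)$ over the states $u$ of internal energy $U$ ($-\infty$ if there are none), let $\beta^{\mathrm{eq},\pm}_{\mathcal P}(U)\in[-\infty,\infty]$ be the right ($+$) and left ($-$) derivative of $S^{\mathrm{eq}}_{\mathcal P}$ at $U$, and let $$\mathbb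 T^{\mathrm{eq}}_{\mathcal P}(U)=\big[\beta^{\mathrm{eq},-}_{\mathcal P}(U)^{-1},\ \beta^{\mathrm{eq},+}_{\mathcal P}(U)^{-1}\big],\qquad \infty^{-1}=0 .$$ Equilibria $u_1,u_2$ of $\mathcal P_1,\mathcal P_2$ are *isothermal* if the product state $(u_1\times u_2)(x,y)=u_1(x)u_2(y)$ is an equilibrium of internal energy $U_{\mathcal P_1}(u_1)+U_{\mathcal P_2}(u_2)$ of $\mathcal P_1\times\mathcal P_2$. **Proposition (characterization of isothermality).** Let $\mathcal P_1,\mathcal P_2$ be K-unstable systems, let $U_i\in\mathfrak U^*_{\mathcal P_i}$, and let $u_i$ be an equilibrium of internal energy $U_i$ of $\mathcal P_i$ $(i=1,2)$. Then $u_1$ and $u_2$ are isothermal if and only if $$\mathbb T^{\mathrm{eq}}_{\mathcal P_1}(U_1)\cap\mathbb T^{\mathrm{eq}}_{\mathcal P_2}(U_2)\neq\emptyset .$$ In this case $$\mathbb T^{\mathrm{eq}}_{\mathcal P_1\times\mathcal P_2}(U_1+U_2)=\mathbb T^{\mathrm{eq}}_{\mathcal P_1}(U_1)\cap\mathbb T^{\mathrm{eq}}_{\mathcal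 P_2}(U_2).$$ -/

import Mathlib

open MeasureTheory Set Filter Topology
open scoped ENNReal

noncomputable section

section Polytopes

variable {V : Type*} [NormedAddCommGroup V] [NormedSpace ℝ V]

/-- `P` is a (full-dimensional, convex) polytope in `V`: a compact set with non-empty interior which
is an intersection of finitely many closed half spaces. -/
def IsPolytope (P : Set V) : Prop :=
  IsCompact P ∧ (interior P).Nonempty ∧
    ∃ s : Set ((V →L[ℝ] ℝ) × ℝ), s.Finite ∧ (∀ a ∈ s, a.1 ≠ 0) ∧ P = {x | ∀ a ∈ s, a.1 x ≤ a.2}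

/-- `F` is a face of `P`: the intersection of `P` with the bounding hyperplane of a half space that
contains `P`. -/
def IsFace (P F : Set V) : Prop :=
  ∃ (f : V →L[ℝ] ℝ) (c : ℝ), f ≠ 0 ∧ (∀ x ∈ P, f x ≤ c) ∧ F = {x ∈ P | f x = c}

/-- A facet of `P`: a (non-empty) face whose affine span has codimension one. -/
def IsFacet (P F : Set V) : Prop :=
  IsFace P F ∧ F.Nonempty ∧
    Module.finrank ℝ (affineSpan ℝ F).direction + 1 = Module.finrank ℝ V

/-- A vertex of `P`: a point `v` such that `{v}` is a face. -/
def IsVertex (P : Set V) (v : V) : Prop := IsFace P {v}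

/-- A simple polytope: through every vertex pass exactly `n = dim V` facets. -/
def IsSimplePolytope (P : Set V) : Prop :=
  IsPolytope P ∧ ∀ v, IsVertex P v → {F | IsFacet P F ∧ v ∈ F}.encard = Module.finrank ℝ V

variable [MeasurableSpace V]

/-- `ν` is a flat measure on the polytope `P`: the restriction to `P` of a translation invariant
measure on `V` (finite on compact sets, positive on non-empty open sets). -/
def IsFlatMeasure (P : Set V) (ν : Measure V) : Prop :=
  ∃ m : Measure V, m.IsAddHaarMeasure ∧ ν = m.restrict P

/-- `ν` is a flat measure on the face `F`: the restriction to `F` of a translation invariant measure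
on the affine span of `F`, which is written as `p + (direction)` for a point `p ∈ F`. -/
def IsFlatFaceMeasure (F : Set V) (ν : Measure V) : Prop :=
  ∃ p ∈ F, ∃ m : Measure (affineSpan ℝ F).direction, m.IsAddHaarMeasure ∧
    ν = (m.map (fun w : (affineSpan ℝ F).direction => (w : V) + p)).restrict F

/-- `σ` is a flat measure on the boundary of `P`: it is carried by `∂P` and its restriction to every
facet is flat. -/
def IsFlatBoundaryMeasure (P : Set V) (σ : Measure V) : Prop :=
  σ (frontier P)ᶜ = 0 ∧ ∀ F, IsFacet P F → IsFlatFaceMeasure F (σ.restrict F)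

end Polytopes

/-- The data of a triple `(P, dμ, dσ)` in `V`. -/
structure HamiltonianTriple (V : Type*) [MeasurableSpace V] where
  /-- the polytope -/
  P : Set V
  /-- the measure on `P` -/
  μ : Measure V
  /-- the measure on the boundary of `P` -/
  σ : Measure V

namespace HamiltonianTriple

section Basic

variable {V : Type*} [NormedAddCommGroup V] [NormedSpace ℝ V] [MeasurableSpace V]

/-- A (simple non-archimedean Hamiltonian) system: `P` is a simple polytope, `dμ` a flat measure on
`P` and `dσ` a flat measure on `∂P`. -/
structure IsSystem (H : HamiltonianTriple V) : Prop where
  simple : IsSimplePolytope H.P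
  flat : IsFlatMeasure H.P H.μ
  flat_boundary : IsFlatBoundaryMeasure H.P H.σ

/-- `u` restricted to `P` is a state: a lower semicontinuous log convex function `P → (0, ∞]` with
`∫_P u dμ = ∫_P dμ`. The values of `u` outside `P` play no role. -/
structure IsState (H : HamiltonianTriple V) (u : V → ℝ≥0∞) : Prop where
  pos : ∀ x ∈ H.P, 0 < u x
  lsc : LowerSemicontinuousOn u H.P
  logConvex : ∀ x ∈ H.P, ∀ y ∈ H.P, ∀ t : ℝ, 0 ≤ t → t ≤ 1 →
    u ((1 - t) • x + t • y) ≤ u x ^ (1 - t) * u y ^ t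
  normalized : ∫⁻ x in H.P, u x ∂H.μ = H.μ H.P

/-- The integrand `u log u` of the entropy, with values in `(-∞, ∞]`. -/
def mulLog (a : ℝ≥0∞) : EReal := (a : EReal) * ENNReal.log a

/-- The entropy `S(u) = -(∫_P dμ)⁻¹ ∫_P u log u dμ ∈ [-∞, 0]`. The integral is the difference of the
integrals of the positive and the negative part of `u log u`; the latter is always finite. -/
def entropy (H : HamiltonianTriple V) (u : V → ℝ≥0∞) : EReal :=
  -((((∫⁻ x in H.P, (mulLog (u x)).toENNReal ∂H.μ : ℝ≥0∞) : EReal)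
      - ((∫⁻ x in H.P, (-mulLog (u x)).toENNReal ∂H.μ : ℝ≥0∞) : EReal))
    / ((H.μ H.P : ℝ≥0∞) : EReal))

/-- The internal energy `U(u) = (∫_P dμ)⁻¹ ∫_{∂P} u dσ ∈ (0, ∞]`. -/
def energy (H : HamiltonianTriple V) (u : V → ℝ≥0∞) : EReal :=
  (((∫⁻ x in frontier H.P, u x ∂H.σ) / H.μ H.P : ℝ≥0∞) : EReal)

/-- The set of states of internal energy `U`. -/
def levelSet (H : HamiltonianTriple V) (U : EReal) : Set (V → ℝ≥0∞) :=
  {u | H.IsState u ∧ H.energy u = U}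

/-- `u` is an equilibrium of internal energy `U`: it maximizes the entropy on the energy level. -/
def IsEquilibrium (H : HamiltonianTriple V) (U : EReal) (u : V → ℝ≥0∞) : Prop :=
  u ∈ H.levelSet U ∧ ∀ v ∈ H.levelSet U, H.entropy v ≤ H.entropy u

/-- The minimum of the internal energy over all states. -/
def minEnergy (H : HamiltonianTriple V) : EReal :=
  sInf (H.energy '' {u | H.IsState u})

/-- The half-open interval `[min U, U(1_P))` of energies. -/
def energyInterval (H : HamiltonianTriple V) : Set ℝ :=
  {U | H.minEnergy ≤ (U : EReal) ∧ (U : EReal) < H.energy fun _ => 1}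

/-- The Donaldson–Futaki invariant of a function `q` on `P`. -/
def donaldsonFutaki (H : HamiltonianTriple V) (q : V → ℝ) : ℝ :=
  2 * Real.pi / H.μ.real H.P *
    ((∫ x in frontier H.P, q x ∂H.σ) -
      H.σ.real (frontier H.P) / H.μ.real H.P * ∫ x in H.P, q x ∂H.μ)

/-- `H` is K-unstable: some integrable convex function on `P` has negative Donaldson–Futaki
invariant. -/
def KUnstable (H : HamiltonianTriple V) : Prop :=
  ∃ q : V → ℝ, ConvexOn ℝ H.P q ∧ IntegrableOn q H.P H.μ ∧
    IntegrableOn q (frontier H.P) H.σ ∧ H.donaldsonFutaki q < 0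

/-- The equilibrium entropy `S^eq(U)`: the supremum of the entropy over the states of energy `U`
(it is `-∞` if there are none). -/
def eqEntropy (H : HamiltonianTriple V) (U : ℝ) : EReal :=
  sSup (H.entropy '' H.levelSet U)

/-- The right derivative of the equilibrium entropy, as a limit in `[-∞, ∞]`. -/
def betaRight (H : HamiltonianTriple V) (U : ℝ) : EReal :=
  limUnder (𝓝[>] (0 : ℝ)) fun h => (H.eqEntropy (U + h) - H.eqEntropy U) / (h : EReal)

/-- The left derivative of the equilibrium entropy, as a limit in `[-∞, ∞]`. -/
def betaLeft (H : HamiltonianTriple V) (U : ℝ) : EReal :=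
  limUnder (𝓝[<] (0 : ℝ)) fun h => (H.eqEntropy (U + h) - H.eqEntropy U) / (h : EReal)

/-- The equilibrium temperature interval `𝕋^eq(U) = [1 / β⁻(U), 1 / β⁺(U)]`, with `1 / ∞ = 0`. -/
def tempInterval (H : HamiltonianTriple V) (U : ℝ) : Set EReal :=
  Set.Icc (H.betaLeft U)⁻¹ (H.betaRight U)⁻¹

end Basic

section Composite

variable {V₁ V₂ : Type*} [NormedAddCommGroup V₁] [NormedSpace ℝ V₁] [MeasurableSpace V₁]
  [NormedAddCommGroup V₂] [NormedSpace ℝ V₂] [MeasurableSpace V₂]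

/-- The composite system `(P₁ × P₂, dμ₁ × dμ₂, dσ₁ × dμ₂ + dμ₁ × dσ₂)`. -/
def composite (H₁ : HamiltonianTriple V₁) (H₂ : HamiltonianTriple V₂) :
    HamiltonianTriple (V₁ × V₂) where
  P := H₁.P ×ˢ H₂.P
  μ := H₁.μ.prod H₂.μ
  σ := H₁.σ.prod H₂.μ + H₁.μ.prod H₂.σ

/-- The product `(u' × u'')(x, y) = u'(x) u''(y)`. -/
def prodState (u' : V₁ → ℝ≥0∞) (u'' : V₂ → ℝ≥0∞) : V₁ × V₂ → ℝ≥0∞ :=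
  fun z => u' z.1 * u'' z.2

/-- Two equilibria `u'`, `u''` are isothermal if `u' × u''` is the equilibrium of internal energy
`U(u') + U(u'')` on the composite system. -/
def Isothermal (H₁ : HamiltonianTriple V₁) (H₂ : HamiltonianTriple V₂)
    (u' : V₁ → ℝ≥0∞) (u'' : V₂ → ℝ≥0∞) : Prop :=
  (H₁.composite H₂).IsEquilibrium (H₁.energy u' + H₂.energy u'') (prodState u' u'')

end Composite

end HamiltonianTriple

end

/-! ### Facets of polytopes and the covering of the boundary. -/

section Facets

variable {V : Type*} [NormedAddCommGroup V] [NormedSpace ℝ V]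

/-! Everything rests on one fact: the equilibrium entropy of the composite is the sup-convolution of
those of the factors, `S₁₂(U) = sup {S₁(E₁) + S₂(E₂) | E₁ + E₂ = U}`. The inequality `≥` holds
because product states are competitors whose energy and entropy are sums (`eqEntropy_add_le`). For
`≤`, a state of the composite is replaced by its two marginals. These are again states (Hölder gives
log convexity, Fatou lower semicontinuity), their energies add up to the given energy
(`exists_energy_marginal`), and by Gibbs' inequality their entropies add up to at least the given
entropy (`entropy_le_marginal`).

Hence `u₁` and `u₂` are isothermal exactly when `(U₁, U₂)` maximizes `S₁(E₁) + S₂(E₂)` on the line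
`E₁ + E₂ = U₁ + U₂`. Mixing states shows that the equilibrium entropy is concave
(`eqEntropy_concave`), so this says that the right derivative of each function is at most the left
derivative of the other (`forall_add_le_iff`): the intervals of supergradients meet. At a point
where a sup-convolution is attained, its interval of supergradients is the intersection of the two
(`slopes_supConvolution`). Inverting slopes yields the temperature intervals. Inversion reverses
order because all slopes involved are positive: an equilibrium of energy below that of the constant
state has negative entropy, while the constant state has entropy zero.

The analytic input is that a state of finite energy has finite entropy (`klInt_ne_top`); it makes
the values at `U₁`, `U₂` finite and the subadditivity applicable to marginals. On the segment from
an interior point to a boundary point `y`, log convexity bounds `u` by `c ^ (1 - r) * u y ^ r`, and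
`∫₀¹ A ^ r log A dr = A - 1` bounds the entropy along the segment linearly in `u y`. Cone
coordinates over the facets turn this into a bound by the energy. Facets enter only here and in the
finiteness of `σ`; the rest uses `IsTame`, which passes to composites without a description of their
facets. -/

theorem interior_lt_of_forall_le {P : Set V} {f : V →L[ℝ] ℝ} {c : ℝ} (hf : f ≠ 0)
    (h : ∀ x ∈ P, f x ≤ c) {x : V} (hx : x ∈ interior P) : f x < c := by
  have hsub : interior P ⊆ {y | f y ≤ c} := fun y hy => h y (interior_subset hy)
  obtain ⟨v, hv⟩ : ∃ v, 0 < f v := by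
    by_contra! hcon
    apply hf
    ext v
    have h1 := hcon v
    have h2 := hcon (-v)
    simp at h2 ⊢
    linarith
  have hcont : Tendsto (fun t : ℝ => x + t • v) (𝓝[>] 0) (𝓝 x) := by
    have : Continuous fun t : ℝ => x + t • v := by fun_prop
    have h0 := this.tendsto 0
    simp only [zero_smul, add_zero] at h0
    exact h0.mono_left nhdsWithin_le_nhds
  obtain ⟨t, ht, ht0⟩ := ((hcont.eventually (isOpen_interior.mem_nhds hx)).and
    self_mem_nhdsWithin).exists
  have h1 := hsub ht
  have ht0 : 0 < t := ht0
  simp only [mem_ofPred_eq, map_add, map_smul, smul_eq_mul] at h1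
  nlinarith [mul_pos ht0 hv]

theorem direction_affineSpan_le_ker {F : Set V} {f : V →L[ℝ] ℝ} {c : ℝ}
    (h : ∀ x ∈ F, f x = c) : (affineSpan ℝ F).direction ≤ LinearMap.ker (f : V →ₗ[ℝ] ℝ) := by
  rw [direction_affineSpan, vectorSpan_def, Submodule.span_le]
  rintro _ ⟨x, hx, y, hy, rfl⟩
  simp [h x hx, h y hy]

/-- The span of the face has directions in `ker f`. Conversely each `v` in `ker f` is a multiple of
the difference of two points of the face, by the local condition at `w`, so the codimension is
exactly one. -/
theorem isFacet_of_local {P F : Set V} [FiniteDimensional ℝ V] {f : V →L[ℝ] ℝ} {c : ℝ}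
    (hf : f ≠ 0) (h : ∀ x ∈ P, f x ≤ c) (hF : F = {x ∈ P | f x = c}) {w : V} (hw : w ∈ F)
    (hloc : ∀ v, f v = 0 → ∀ᶠ t in 𝓝[>] (0 : ℝ), w + t • v ∈ P) : IsFacet P F := by
  refine ⟨⟨f, c, hf, h, hF⟩, ⟨w, hw⟩, ?_⟩
  have hle := direction_affineSpan_le_ker (F := F) (f := f) (c := c) (by
    intro x hx; rw [hF] at hx; exact hx.2)
  have hge : LinearMap.ker (f : V →ₗ[ℝ] ℝ) ≤ (affineSpan ℝ F).direction := by
    intro v hv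
    have hv : f v = 0 := by simpa using hv
    obtain ⟨t, ht, ht0⟩ := ((hloc v hv).and self_mem_nhdsWithin).exists
    have ht0 : 0 < t := ht0
    have hmem : w + t • v ∈ F := by
      rw [hF] at hw ⊢
      exact ⟨ht, by simp [hv, hw.2]⟩
    have h1 : t • v ∈ (affineSpan ℝ F).direction := by
      have := AffineSubspace.vsub_mem_direction (subset_affineSpan ℝ F hmem)
        (subset_affineSpan ℝ F hw)
      simpa using this
    have := Submodule.smul_mem _ t⁻¹ h1
    rwa [smul_smul, inv_mul_cancel₀ ht0.ne', one_smul] at this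
  rw [le_antisymm hle hge]
  apply Module.Dual.finrank_ker_add_one_of_ne_zero
  intro h0
  exact hf (by ext v; simpa using congrArg (fun g => g v) h0)

/-- A polytope is defined by a finite set of half spaces none of which can be omitted. -/
theorem IsPolytope.exists_irredundant {P : Set V} (hP : IsPolytope P) :
    ∃ s : Finset ((V →L[ℝ] ℝ) × ℝ), (∀ a ∈ s, a.1 ≠ 0) ∧ P = {x | ∀ a ∈ s, a.1 x ≤ a.2} ∧
      ∀ a ∈ s, ∃ y, (∀ b ∈ s, b ≠ a → b.1 y ≤ b.2) ∧ a.2 < a.1 y := by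
  classical
  obtain ⟨-, -, s₀, hfin, hne, hPs⟩ := hP
  -- A description by the least possible number of half spaces is irredundant.
  have hex : ∃ n : ℕ, ∃ s : Finset ((V →L[ℝ] ℝ) × ℝ), s.card = n ∧ (∀ a ∈ s, a.1 ≠ 0) ∧
      P = {x | ∀ a ∈ s, a.1 x ≤ a.2} :=
    ⟨_, hfin.toFinset, rfl, by simpa using hne, by simpa using hPs⟩
  obtain ⟨s, hcard, hs0, hs⟩ := Nat.find_spec hex
  refine ⟨s, hs0, hs, fun a ha => ?_⟩
  by_contra! hcon
  have hlt : (s.erase a).card < Nat.find hex := by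
    rw [← hcard]; exact Finset.card_erase_lt_of_mem ha
  refine Nat.find_min hex hlt ⟨s.erase a, rfl, fun b hb => hs0 b (Finset.mem_of_mem_erase hb), ?_⟩
  rw [hs]
  ext x
  simp only [mem_ofPred_eq, Finset.mem_erase]
  refine ⟨fun h b hb => h b hb.2, fun h b hb => ?_⟩
  by_cases hba : b = a
  · subst hba
    exact hcon x fun b' hb' hne => h b' ⟨hne, hb'⟩
  · exact h b ⟨hba, hb⟩

/-- The boundary of a polytope is covered by finitely many facets. -/
theorem IsPolytope.frontier_subset_facets [FiniteDimensional ℝ V] {P : Set V} (hP : IsPolytope P) :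
    ∃ T : Set (Set V), T.Finite ∧ (∀ F ∈ T, IsFacet P F) ∧ frontier P ⊆ ⋃₀ T := by
  obtain ⟨s, hs0, hs, hirr⟩ := hP.exists_irredundant
  obtain ⟨z, hz⟩ := hP.2.1
  have hle : ∀ a ∈ s, ∀ x ∈ P, a.1 x ≤ a.2 := by
    intro a ha x hx; rw [hs] at hx; exact hx a ha
  refine ⟨(fun a : (V →L[ℝ] ℝ) × ℝ => {x ∈ P | a.1 x = a.2}) '' s, s.finite_toSet.image _, ?_, ?_⟩
  · rintro _ ⟨a, ha, rfl⟩
    -- The point `y` violates only the constraint `a`. The segment from the interior point `z` to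
    -- `y` crosses the hyperplane of `a` at parameter `τ`, where all other constraints are strict;
    -- near that point the face is the whole hyperplane.
    obtain ⟨y, hy, hay⟩ := hirr a ha
    have hza := interior_lt_of_forall_le (hs0 a ha) (hle a ha) hz
    set τ := (a.2 - a.1 z) / (a.1 y - a.1 z) with hτ
    have hd : 0 < a.1 y - a.1 z := by linarith
    have hτ0 : 0 < τ := div_pos (by linarith) hd
    have hτ1 : τ < 1 := by rw [hτ, div_lt_one hd]; linarith
    have haw : a.1 (z + τ • (y - z)) = a.2 := by
      simp only [map_add, map_smul, map_sub, smul_eq_mul]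
      rw [hτ, div_mul_cancel₀ _ hd.ne']; ring
    have hbw : ∀ b ∈ s, b ≠ a → b.1 (z + τ • (y - z)) < b.2 := by
      intro b hb hba
      have h1 := hy b hb hba
      have h2 := interior_lt_of_forall_le (hs0 b hb) (hle b hb) hz
      simp only [map_add, map_smul, map_sub, smul_eq_mul]
      nlinarith
    have hwP : z + τ • (y - z) ∈ P := by
      rw [hs]
      intro b hb
      by_cases hba : b = a
      · rw [hba]; exact haw.le
      · exact (hbw b hb hba).le
    refine isFacet_of_local (hs0 a ha) (hle a ha) rfl ⟨hwP, haw⟩ fun v hv => ?_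
    have hev : ∀ᶠ t in 𝓝[>] (0 : ℝ), ∀ b ∈ s, b.1 (z + τ • (y - z) + t • v) ≤ b.2 := by
      rw [Filter.eventually_all_finset]
      intro b hb
      by_cases hba : b = a
      · subst hba
        refine Eventually.of_forall fun t => ?_
        rw [map_add, haw]
        simp [hv]
      · have hc : Continuous fun t : ℝ => b.1 (z + τ • (y - z) + t • v) := by fun_prop
        have h0 := hc.tendsto 0
        simp only [zero_smul, add_zero] at h0
        exact ((h0.mono_left nhdsWithin_le_nhds).eventually_lt_const (hbw b hb hba)).mono
          fun t ht => ht.le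
    filter_upwards [hev] with t ht
    rw [hs]; exact ht
  · intro x hx
    have hxP : x ∈ P := hP.1.isClosed.frontier_subset hx
    by_contra hcon
    apply hx.2
    have hlt : ∀ a ∈ s, a.1 x < a.2 := by
      intro a ha
      refine lt_of_le_of_ne (hle a ha x hxP) fun heq => hcon ?_
      exact ⟨_, ⟨a, ha, rfl⟩, hxP, heq⟩
    rw [mem_interior]
    refine ⟨⋂ a ∈ s, {y | a.1 y < a.2}, ?_, ?_, ?_⟩
    · intro y hy
      rw [hs]
      intro a ha
      simp only [mem_iInter] at hy
      exact (hy a ha : a.1 y < a.2).le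
    · exact isOpen_biInter_finset fun a _ => isOpen_lt a.1.continuous continuous_const
    · simpa using fun f c h => hlt (f, c) h

theorem IsPolytope.convex {P : Set V} (hP : IsPolytope P) : Convex ℝ P := by
  obtain ⟨-, -, s, -, -, rfl⟩ := hP
  have : {x : V | ∀ a ∈ s, a.1 x ≤ a.2} = ⋂ a ∈ s, {x | a.1 x ≤ a.2} := by ext; simp
  rw [this]
  exact convex_iInter₂ fun a _ => convex_halfSpace_le a.1.toLinearMap.isLinear a.2

theorem IsFacet.isCompact {P F : Set V} (hP : IsCompact P) (hF : IsFacet P F) : IsCompact F := by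
  obtain ⟨⟨f, c, -, -, rfl⟩, -, -⟩ := hF
  exact hP.inter_right (isClosed_eq f.continuous continuous_const)

end Facets

/-! ### Finiteness of flat measures on facets and on the boundary. -/

section Cone

variable {V : Type*} [NormedAddCommGroup V] [NormedSpace ℝ V] [MeasurableSpace V] [BorelSpace V]
  [FiniteDimensional ℝ V]

theorem IsFlatFaceMeasure.univ_lt_top {F : Set V} (hF : IsCompact F) {ν : Measure V}
    (hν : IsFlatFaceMeasure F ν) : ν univ < ∞ := by
  obtain ⟨p, -, m, hm, rfl⟩ := hν
  have hemb : IsClosedEmbedding fun w : (affineSpan ℝ F).direction => (w : V) + p :=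
    (Homeomorph.addRight p).isClosedEmbedding.comp
      (Submodule.closed_of_finiteDimensional _).isClosedEmbedding_subtypeVal
  rw [Measure.restrict_apply_univ, Measure.map_apply hemb.continuous.measurable hF.measurableSet]
  exact (hemb.isCompact_preimage hF).measure_lt_top

/-- Flatness controls `σ` only facet by facet; finiteness follows since finitely many compact facets
cover the frontier, which carries `σ`. -/
theorem IsFlatBoundaryMeasure.isFiniteMeasure {P : Set V} (hP : IsPolytope P) {σ : Measure V}
    (hσ : IsFlatBoundaryMeasure P σ) : IsFiniteMeasure σ := by
  obtain ⟨T, hT, hTF, hcov⟩ := hP.frontier_subset_facets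
  refine ⟨?_⟩
  have h1 : σ univ ≤ σ (frontier P) + σ (frontier P)ᶜ := by
    rw [← union_compl_self (frontier P)]; exact measure_union_le _ _
  rw [hσ.1, add_zero] at h1
  refine h1.trans_lt ((measure_mono hcov).trans_lt ?_)
  rw [sUnion_eq_biUnion]
  refine (measure_biUnion_lt_top hT fun F hF => ?_)
  have := (hσ.2 F (hTF F hF)).univ_lt_top ((hTF F hF).isCompact hP.1)
  rwa [Measure.restrict_apply_univ] at this

end Cone

/-! ### Integration in cone coordinates over a facet. -/

section ConeIntegral

variable {V : Type*} [NormedAddCommGroup V] [NormedSpace ℝ V] [MeasurableSpace V] [BorelSpace V]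
  [FiniteDimensional ℝ V]

/-- Integrals over a Haar measure on a finite dimensional space under a dilation by a factor in
`(0, 1]`. -/
theorem lintegral_le_lintegral_comp_smul {E : Type*} [NormedAddCommGroup E] [NormedSpace ℝ E]
    [MeasurableSpace E] [BorelSpace E] [FiniteDimensional ℝ E] (m : Measure E)
    [m.IsAddHaarMeasure] {G : E → ℝ≥0∞} (hG : Measurable G) {r : ℝ} (hr0 : 0 < r) (hr1 : r ≤ 1) :
    ∫⁻ w, G w ∂m ≤ ∫⁻ w, G (r • w) ∂m := by
  have h1 : ∫⁻ w, G (r • w) ∂m = ∫⁻ w, G w ∂(m.map (r • ·)) :=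
    (lintegral_map hG (measurable_const_smul r)).symm
  rw [h1, Measure.map_addHaar_smul m hr0.ne', lintegral_smul_measure]
  have h2 : 1 ≤ ENNReal.ofReal |(r ^ Module.finrank ℝ E)⁻¹| := by
    rw [ENNReal.one_le_ofReal, abs_of_pos (by positivity)]
    exact (one_le_inv₀ (by positivity)).2 (pow_le_one₀ hr0.le hr1)
  calc ∫⁻ w, G w ∂m = 1 * ∫⁻ w, G w ∂m := (one_mul _).symm
    _ ≤ _ := by rw [smul_eq_mul]; gcongr

omit [FiniteDimensional ℝ V] in
theorem lintegral_map_add_restrict {F : Set V} (hF : MeasurableSet F) {p : V} {D : Submodule ℝ V}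
    (m : Measure D) {h : V → ℝ≥0∞} (hh : Measurable h) :
    ∫⁻ y, h y ∂((m.map (fun w : D => (w : V) + p)).restrict F) =
      ∫⁻ w : D, F.indicator h ((w : V) + p) ∂m := by
  rw [← lintegral_indicator hF, lintegral_map (hh.indicator hF) (by fun_prop)]

/-- With `e = p - x₀` transversal to `D`, the map `(w, r) ↦ w + r • e` identifies `D × ℝ` with `V`,
and uniqueness of Haar measure supplies `C`. The slice of the cone at height `r` is the `r`-dilate
of the facet. Its Jacobian is a nonnegative power of `r ≤ 1` and is simply dropped, which is why an
inequality is obtained. -/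
theorem lintegral_cone_le_of_submodule {F : Set V} (hFc : IsCompact F) {f : V →L[ℝ] ℝ} {c : ℝ}
    (hfF : ∀ x ∈ F, f x = c) {x₀ : V} (hx₀ : f x₀ < c) {D : Submodule ℝ V}
    (hfD : ∀ w : D, f w = 0) (hrank : Module.finrank ℝ D + 1 = Module.finrank ℝ V)
    {p : V} (hp : p ∈ F) (m : Measure D) [m.IsAddHaarMeasure]
    (μ₀ : Measure V) [μ₀.IsAddHaarMeasure] :
    ∃ C : ℝ≥0∞, C ≠ ∞ ∧ ∀ g : V → ℝ≥0∞, Measurable g →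
      ∫⁻ x in (fun q : V × ℝ => x₀ + q.2 • (q.1 - x₀)) '' (F ×ˢ Icc 0 1), g x ∂μ₀ ≤
        C * ∫⁻ y, (∫⁻ r in Ioc (0 : ℝ) 1, g (x₀ + r • (y - x₀)) ∂volume)
          ∂((m.map (fun w : D => (w : V) + p)).restrict F) := by
  set e : V := p - x₀ with he
  have hδ : 0 < f e := by
    rw [he, map_sub, hfF p hp]; linarith
  have : SecondCountableTopology D := by
    have : ProperSpace D := FiniteDimensional.proper ℝ D
    infer_instance
  let Φ₀ : (D × ℝ) →ₗ[ℝ] V :=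
    D.subtype.comp (LinearMap.fst ℝ D ℝ) + (LinearMap.snd ℝ D ℝ).smulRight e
  have hΦ₀ : ∀ q : D × ℝ, Φ₀ q = (q.1 : V) + q.2 • e := fun q => by simp [Φ₀]
  have hinj : Function.Injective Φ₀ := by
    rw [← LinearMap.ker_eq_bot, LinearMap.ker_eq_bot']
    intro q hq
    rw [hΦ₀] at hq
    have h1 := congrArg f hq
    simp only [map_add, map_smul, hfD, smul_eq_mul, zero_add, map_zero] at h1
    have h2 : q.2 = 0 := by
      rcases mul_eq_zero.1 h1 with h | h
      · exact h
      · exact absurd h hδ.ne'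
    rw [h2] at hq
    have h3 : q.1 = 0 := by simpa using hq
    exact Prod.ext h3 h2
  let Φ : (D × ℝ) ≃L[ℝ] V :=
    (LinearMap.linearEquivOfInjective Φ₀ hinj (by
      rw [Module.finrank_prod, Module.finrank_self]; exact hrank)).toContinuousLinearEquiv
  have hΦ : ∀ q : D × ℝ, Φ q = (q.1 : V) + q.2 • e := hΦ₀
  have : ((m.prod (volume : Measure ℝ)).map Φ).IsAddHaarMeasure := Φ.isAddHaarMeasure_map _
  obtain ⟨C, hC⟩ : ∃ C : NNReal, μ₀ = C • (m.prod (volume : Measure ℝ)).map Φ :=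
    ⟨_, Measure.isAddLeftInvariant_eq_smul _ _⟩
  refine ⟨C, ENNReal.coe_ne_top, fun g hg => ?_⟩
  set K := (fun q : V × ℝ => x₀ + q.2 • (q.1 - x₀)) '' (F ×ˢ Icc 0 1) with hK
  have hKm : MeasurableSet K :=
    ((hFc.prod isCompact_Icc).image (by fun_prop)).measurableSet
  have hGm : Measurable (K.indicator g) := hg.indicator hKm
  have hmemK : ∀ (w : D) (r : ℝ), x₀ + ((w : V) + r • e) ∈ K →
      ∃ y ∈ F, r ∈ Icc (0 : ℝ) 1 ∧ (w : V) + r • e = r • (y - x₀) := by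
    rintro w r ⟨⟨y, s⟩, ⟨hy, hs⟩, hq⟩
    have hq' : s • (y - x₀) = (w : V) + r • e := by simpa using hq
    have h1 := congrArg f hq'
    simp only [map_add, map_smul, hfD, smul_eq_mul, zero_add] at h1
    have h2 : f (y - x₀) = f e := by rw [he, map_sub, map_sub, hfF y hy, hfF p hp]
    rw [h2] at h1
    have h3 : s = r := mul_right_cancel₀ hδ.ne' h1
    subst h3
    exact ⟨y, hy, hs, hq'.symm⟩
  have hinner : ∀ r : ℝ, r ≠ 0 → ∫⁻ w : D, K.indicator g (x₀ + ((w : V) + r • e)) ∂m ≤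
      (Ioc (0 : ℝ) 1).indicator (fun r => ∫⁻ w : D,
        F.indicator (fun y => g (x₀ + r • (y - x₀))) ((w : V) + p) ∂m) r := by
    intro r hr
    by_cases hrI : r ∈ Ioc (0 : ℝ) 1
    · rw [indicator_of_mem hrI]
      refine (lintegral_le_lintegral_comp_smul m
        (hGm.comp (by fun_prop : Measurable fun w : D => x₀ + ((w : V) + r • e)))
        hrI.1 hrI.2).trans (lintegral_mono fun w => ?_)
      simp only [Function.comp_apply]
      by_cases hmem : x₀ + (((r • w : D) : V) + r • e) ∈ K
      · obtain ⟨y, hy, -, hyr⟩ := hmemK _ _ hmem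
        have hyw : y = (w : V) + p := by
          have : r • ((w : V) + e) = r • (y - x₀) := by rw [← hyr]; simp
          have := smul_right_injective V hr this
          rw [he] at this
          have h4 : (w : V) + (p - x₀) + x₀ = y := by rw [this]; abel
          rw [← h4]; abel
        rw [indicator_of_mem hmem, indicator_of_mem (by rw [← hyw]; exact hy), ← hyw, hyr]
      · rw [indicator_of_notMem hmem]; exact zero_le
    · rw [indicator_of_notMem hrI, nonpos_iff_eq_zero, ← lintegral_zero (μ := m)]
      congr 1
      ext w
      apply indicator_of_notMem
      intro hmem
      obtain ⟨-, -, hr', -⟩ := hmemK _ _ hmem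
      exact hrI ⟨lt_of_le_of_ne hr'.1 hr.symm, hr'.2⟩
  have hjoint : Measurable fun q : V × ℝ => g (x₀ + q.2 • (q.1 - x₀)) := by fun_prop
  have hjoint' : Measurable fun q : ℝ × D =>
      F.indicator (fun y => g (x₀ + q.1 • (y - x₀))) ((q.2 : V) + p) := by
    have h1 : Measurable fun q : ℝ × D => g (x₀ + q.1 • ((q.2 : V) + p - x₀)) := by fun_prop
    have h2 : MeasurableSet {q : ℝ × D | (q.2 : V) + p ∈ F} :=
      (by fun_prop : Measurable fun q : ℝ × D => (q.2 : V) + p) hFc.measurableSet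
    exact h1.indicator h2
  calc ∫⁻ x in K, g x ∂μ₀ = ∫⁻ x, K.indicator g (x₀ + x) ∂μ₀ := by
        rw [lintegral_add_left_eq_self, lintegral_indicator hKm]
    _ = C * ∫⁻ q : D × ℝ, K.indicator g (x₀ + ((q.1 : V) + q.2 • e)) ∂(m.prod volume) := by
        rw [hC, lintegral_smul_measure, lintegral_map (by fun_prop) Φ.continuous.measurable]
        simp only [hΦ]
        rfl
    _ = C * ∫⁻ r : ℝ, ∫⁻ w : D, K.indicator g (x₀ + ((w : V) + r • e)) ∂m := by
        rw [lintegral_prod_symm _ (by fun_prop)]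
    _ ≤ C * ∫⁻ r in Ioc (0 : ℝ) 1, ∫⁻ w : D,
          F.indicator (fun y => g (x₀ + r • (y - x₀))) ((w : V) + p) ∂m := by
        refine mul_le_mul_right ?_ _
        rw [← lintegral_indicator measurableSet_Ioc]
        refine lintegral_mono_ae ?_
        filter_upwards [Measure.ae_ne volume (0 : ℝ)] with r hr using hinner r hr
    _ = C * ∫⁻ w : D, (∫⁻ r in Ioc (0 : ℝ) 1,
          F.indicator (fun y => g (x₀ + r • (y - x₀))) ((w : V) + p) ∂volume) ∂m := by
        rw [lintegral_lintegral_swap hjoint'.aemeasurable]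
    _ = _ := by
        rw [lintegral_map_add_restrict hFc.measurableSet m
          (Measurable.lintegral_prod_right' (f := fun q : V × ℝ => g (x₀ + q.2 • (q.1 - x₀)))
            hjoint)]
        congr 2
        ext w
        by_cases hw : (w : V) + p ∈ F
        · simp [hw]
        · simp [hw]

/-- The integral over the cone with apex an interior point `x₀` over a facet, in terms of a flat
measure on that facet. -/
theorem lintegral_cone_le {P F : Set V} (hP : IsCompact P) (hF : IsFacet P F) {x₀ : V}
    (hx₀ : x₀ ∈ interior P) (μ₀ : Measure V) [μ₀.IsAddHaarMeasure] {ν : Measure V}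
    (hν : IsFlatFaceMeasure F ν) :
    ∃ C : ℝ≥0∞, C ≠ ∞ ∧ ∀ g : V → ℝ≥0∞, Measurable g →
      ∫⁻ x in (fun q : V × ℝ => x₀ + q.2 • (q.1 - x₀)) '' (F ×ˢ Icc 0 1), g x ∂μ₀ ≤
        C * ∫⁻ y, (∫⁻ r in Ioc (0 : ℝ) 1, g (x₀ + r • (y - x₀)) ∂volume) ∂ν := by
  have hFc := hF.isCompact hP
  obtain ⟨p, hp, m, hm, rfl⟩ := hν
  obtain ⟨⟨f, c, hf, hle, hFeq⟩, -, hrank⟩ := hF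
  have hfF : ∀ x ∈ F, f x = c := fun x hx => by rw [hFeq] at hx; exact hx.2
  exact lintegral_cone_le_of_submodule hFc hfF (interior_lt_of_forall_le hf hle hx₀)
    (fun w => by simpa using direction_affineSpan_le_ker hfF w.2) hrank hp m μ₀

end ConeIntegral

/-! ### Borel representatives of states. -/

section Measurability

/-- A state is unconstrained off `P`. Since `P` is closed, the value `∞` there preserves lower
semicontinuity, which provides a Borel function on the whole space. -/
theorem LowerSemicontinuousOn.piecewise_top {X : Type*} [TopologicalSpace X]
    {P : Set X} (hP : IsClosed P) {u : X → ℝ≥0∞}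
    (hu : LowerSemicontinuousOn u P) [∀ x, Decidable (x ∈ P)] :
    LowerSemicontinuous (P.piecewise u fun _ => ∞) := by
  intro x a ha
  change a < P.piecewise u (fun _ => ∞) x at ha
  change ∀ᶠ y in 𝓝 x, a < P.piecewise u (fun _ => ∞) y
  by_cases hx : x ∈ P
  · rw [piecewise_eq_of_mem _ _ _ hx] at ha
    have h1 := hu x hx a ha
    rw [eventually_nhdsWithin_iff] at h1
    filter_upwards [h1] with y hy
    by_cases hyP : y ∈ P
    · rw [piecewise_eq_of_mem _ _ _ hyP]; exact hy hyP
    · rw [piecewise_eq_of_notMem _ _ _ hyP]; exact ha.trans_le le_top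
  · rw [piecewise_eq_of_notMem _ _ _ hx] at ha
    filter_upwards [hP.isOpen_compl.mem_nhds hx] with y hy
    rw [piecewise_eq_of_notMem _ _ _ hy]; exact ha

theorem LowerSemicontinuousOn.measurable_piecewise_top {X : Type*} [TopologicalSpace X]
    [MeasurableSpace X] [BorelSpace X] {P : Set X} (hP : IsClosed P) {u : X → ℝ≥0∞}
    (hu : LowerSemicontinuousOn u P) [∀ x, Decidable (x ∈ P)] :
    Measurable (P.piecewise u fun _ => ∞) :=
  (hu.piecewise_top hP).measurable

theorem LowerSemicontinuousOn.aemeasurable_restrict {X : Type*} [TopologicalSpace X]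
    [MeasurableSpace X] [BorelSpace X] {P : Set X} (hP : IsClosed P) {u : X → ℝ≥0∞}
    (hu : LowerSemicontinuousOn u P) (μ : Measure X) : AEMeasurable u (μ.restrict P) := by
  classical
  refine ⟨_, hu.measurable_piecewise_top hP, ?_⟩
  filter_upwards [ae_restrict_mem hP.measurableSet] with x hx
  rw [piecewise_eq_of_mem _ _ _ hx]

end Measurability

/-! ### Entropy of a log convex function along a segment. -/

section OneDimensional

/-- The integrand is the derivative of `A ^ r`. Integration over the segment absorbs the logarithm,
so the bound stays linear in the end value. -/
theorem lintegral_rpow_mul_log {A : ℝ} (hA : 1 ≤ A) :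
    ∫⁻ r in Ioc (0 : ℝ) 1, ENNReal.ofReal (A ^ r * Real.log A) = ENNReal.ofReal (A - 1) := by
  have hA0 : 0 < A := by linarith
  have hc : Continuous fun r : ℝ => A ^ r * Real.log A := by
    refine Continuous.mul ?_ continuous_const
    exact Real.continuous_const_rpow hA0.ne'
  have hint : ∫ r in (0 : ℝ)..1, A ^ r * Real.log A = A - 1 := by
    rw [intervalIntegral.integral_eq_sub_of_hasDerivAt (f := fun r : ℝ => A ^ r)
      (fun r _ => by simpa using Real.hasStrictDerivAt_const_rpow hA0 r |>.hasDerivAt)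
      (hc.intervalIntegrable _ _)]
    simp
  rw [← ofReal_integral_eq_lintegral_ofReal, ← intervalIntegral.integral_of_le zero_le_one, hint]
  · exact (intervalIntegrable_iff_integrableOn_Ioc_of_le zero_le_one).1 (hc.intervalIntegrable _ _)
  · exact Eventually.of_forall fun r =>
      mul_nonneg (Real.rpow_nonneg hA0.le _) (Real.log_nonneg hA)

/-- This replaces monotonicity, which `klFun` lacks on `[0, 1]`: there `v * log v` is nonpositive.
-/
theorem klFun_le_of_le {v w : ℝ} (hv : 0 ≤ v) (hvw : v ≤ w) (hw : 1 ≤ w) :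
    InformationTheory.klFun v ≤ w * Real.log w + 1 := by
  have hw0 : 0 ≤ w * Real.log w := mul_nonneg (by linarith) (Real.log_nonneg hw)
  have h1 : v * Real.log v ≤ w * Real.log w := by
    rcases le_total v 1 with h | h
    · exact (mul_nonpos_of_nonneg_of_nonpos hv (Real.log_nonpos hv h)).trans hw0
    · exact mul_le_mul hvw (Real.log_le_log (by linarith) hvw) (Real.log_nonneg h) (by linarith)
  rw [InformationTheory.klFun_apply]
  linarith

/-- The entropy density of a function on `(0, 1]` bounded by a log affine one is controlled by the
value at the end point. -/
theorem lintegral_klFun_le {c a : ℝ≥0∞} (hc : c ≠ ∞) {v : ℝ → ℝ≥0∞}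
    (hv : ∀ r ∈ Ioc (0 : ℝ) 1, v r ≤ c ^ (1 - r) * a ^ r) :
    ∫⁻ r in Ioc (0 : ℝ) 1, ENNReal.ofReal (InformationTheory.klFun (v r).toReal) ≤
      ENNReal.ofReal (max c.toReal 1 * Real.log (max c.toReal 1) + max c.toReal 1 + 1) *
        (a + 1) := by
  set M := max c.toReal 1 with hM
  have hM1 : 1 ≤ M := le_max_right _ _
  have hM0 : 0 < M := by linarith
  have hlM : 0 ≤ Real.log M := Real.log_nonneg hM1
  have hK : 0 < M * Real.log M + M + 1 := by positivity
  by_cases ha : a = ∞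
  · subst ha
    rw [top_add, ENNReal.mul_top (by simpa using hK)]
    exact le_top
  set A := max a.toReal 1 with hAdef
  have hA1 : 1 ≤ A := le_max_right _ _
  have hA0 : 0 < A := by linarith
  have hlA : 0 ≤ Real.log A := Real.log_nonneg hA1
  -- Here `v r ≤ M * A ^ r`, so `klFun` is at most `M * A ^ r * (log M + r * log A) + 1`; then `A ^
  -- r ≤ A` is used in the first term and `r ≤ 1` in the second.
  have hpt : ∀ r ∈ Ioc (0 : ℝ) 1, ENNReal.ofReal (InformationTheory.klFun (v r).toReal) ≤
      ENNReal.ofReal (M * Real.log M * A + 1) +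
        ENNReal.ofReal M * ENNReal.ofReal (A ^ r * Real.log A) := by
    intro r hr
    have hAr1 : 1 ≤ A ^ r := Real.one_le_rpow hA1 hr.1.le
    have hArA : A ^ r ≤ A := by
      simpa using Real.rpow_le_rpow_of_exponent_le hA1 hr.2
    have hle : (v r).toReal ≤ M * A ^ r := by
      have hfin : c ^ (1 - r) * a ^ r ≠ ∞ := ENNReal.mul_ne_top
        (ENNReal.rpow_ne_top_of_nonneg (by linarith [hr.2]) hc)
        (ENNReal.rpow_ne_top_of_nonneg hr.1.le ha)
      have h1 := ENNReal.toReal_mono hfin (hv r hr)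
      rw [ENNReal.toReal_mul, ← ENNReal.toReal_rpow, ← ENNReal.toReal_rpow] at h1
      have h2 : c.toReal ^ (1 - r) ≤ M := by
        calc c.toReal ^ (1 - r) ≤ M ^ (1 - r) :=
              Real.rpow_le_rpow ENNReal.toReal_nonneg (le_max_left _ _) (by linarith [hr.2])
          _ ≤ M ^ (1 : ℝ) := Real.rpow_le_rpow_of_exponent_le hM1 (by linarith [hr.1])
          _ = M := Real.rpow_one M
      have h3 : a.toReal ^ r ≤ A ^ r :=
        Real.rpow_le_rpow ENNReal.toReal_nonneg (le_max_left _ _) hr.1.le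
      exact h1.trans (mul_le_mul h2 h3 (Real.rpow_nonneg ENNReal.toReal_nonneg _) hM0.le)
    have hkl := klFun_le_of_le ENNReal.toReal_nonneg hle (by nlinarith)
    rw [← ENNReal.ofReal_mul hM0.le, ← ENNReal.ofReal_add (by positivity) (by positivity)]
    refine ENNReal.ofReal_le_ofReal (hkl.trans ?_)
    rw [Real.log_mul hM0.ne' (by positivity), Real.log_rpow hA0]
    have h4 : M * A ^ r * Real.log M ≤ M * Real.log M * A := by
      nlinarith [mul_nonneg hM0.le hlM]
    have h5 : M * A ^ r * (r * Real.log A) ≤ M * (A ^ r * Real.log A) := by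
      have : 0 ≤ M * (A ^ r * Real.log A) := by positivity
      nlinarith [hr.2]
    linarith
  calc _ ≤ ∫⁻ r in Ioc (0 : ℝ) 1, (ENNReal.ofReal (M * Real.log M * A + 1) +
        ENNReal.ofReal M * ENNReal.ofReal (A ^ r * Real.log A)) :=
        setLIntegral_mono' measurableSet_Ioc hpt
    _ = ENNReal.ofReal (M * Real.log M * A + 1) + ENNReal.ofReal M * ENNReal.ofReal (A - 1) := by
        rw [lintegral_add_left measurable_const, lintegral_const_mul' _ _ ENNReal.ofReal_ne_top,
          lintegral_rpow_mul_log hA1]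
        simp
    _ = ENNReal.ofReal (M * Real.log M * A + 1 + M * (A - 1)) := by
        rw [← ENNReal.ofReal_mul hM0.le, ← ENNReal.ofReal_add (by positivity)
          (mul_nonneg hM0.le (by linarith))]
    _ ≤ ENNReal.ofReal ((M * Real.log M + M + 1) * (a.toReal + 1)) := by
        refine ENNReal.ofReal_le_ofReal ?_
        have : A ≤ a.toReal + 1 :=
          max_le (by linarith) (by linarith [ENNReal.toReal_nonneg (a := a)])
        nlinarith [mul_nonneg hM0.le hlM, ENNReal.toReal_nonneg (a := a)]
    _ = _ := by
        rw [ENNReal.ofReal_mul hK.le, ENNReal.ofReal_add ENNReal.toReal_nonneg zero_le_one,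
          ENNReal.ofReal_toReal ha, ENNReal.ofReal_one]

end OneDimensional

/-! ### Cones over the boundary cover the polytope. -/

section Cover

variable {V : Type*} [NormedAddCommGroup V] [NormedSpace ℝ V]

/-- The half line from `x` pointing away from `x₀` is connected and leaves the bounded set `P`, so
it meets the frontier at some parameter `s ≥ 1`; then `r = s⁻¹`. -/
theorem exists_frontier_of_mem {P : Set V} (hP : Bornology.IsBounded P) {x₀ x : V} (hx : x ∈ P)
    (hne : x ≠ x₀) : ∃ y ∈ frontier P, ∃ r ∈ Ioc (0 : ℝ) 1, x₀ + r • (y - x₀) = x := by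
  have hd : 0 < ‖x - x₀‖ := norm_pos_iff.2 (sub_ne_zero.2 hne)
  set γ : ℝ → V := fun s => x₀ + s • (x - x₀) with hγ
  have hcont : Continuous γ := by fun_prop
  obtain ⟨R, hR⟩ := hP.closure.subset_closedBall x₀
  have hpre : IsPreconnected (γ '' Ici 1) := isPreconnected_Ici.image _ hcont.continuousOn
  obtain ⟨_, ⟨s, hs, rfl⟩, hfr⟩ : (γ '' Ici 1 ∩ frontier P).Nonempty := by
    by_contra hcon
    have hcov : γ '' Ici 1 ⊆ interior P ∪ (closure P)ᶜ := fun y hy => by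
      by_contra hy'
      rw [mem_union, not_or, notMem_compl_iff] at hy'
      exact hcon ⟨y, hy, hy'.2, hy'.1⟩
    have hγ1 : x ∈ γ '' Ici 1 := ⟨1, mem_Ici.2 le_rfl, by simp [hγ]⟩
    have hout : γ (max 1 ((R + 1) / ‖x - x₀‖)) ∉ closure P := by
      intro hmem
      have h1 := hR hmem
      rw [mem_closedBall_iff_norm] at h1
      simp only [hγ, add_sub_cancel_left, norm_smul, Real.norm_eq_abs] at h1
      rw [abs_of_pos (lt_of_lt_of_le one_pos (le_max_left _ _))] at h1
      have h2 : (R + 1) / ‖x - x₀‖ * ‖x - x₀‖ ≤ max 1 ((R + 1) / ‖x - x₀‖) * ‖x - x₀‖ := by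
        gcongr; exact le_max_right _ _
      rw [div_mul_cancel₀ _ hd.ne'] at h2
      linarith
    obtain ⟨z, -, hz1, hz2⟩ := hpre _ _ isOpen_interior isClosed_closure.isOpen_compl hcov
      ⟨x, hγ1, (hcov hγ1).resolve_right fun hc => hc (subset_closure hx)⟩
      ⟨_, ⟨max 1 ((R + 1) / ‖x - x₀‖), mem_Ici.2 (le_max_left _ _), rfl⟩, hout⟩
    exact hz2 (subset_closure (interior_subset hz1))
  have hs1 : (1 : ℝ) ≤ s := hs
  refine ⟨_, hfr, s⁻¹, ⟨by positivity, inv_le_one_of_one_le₀ hs1⟩, ?_⟩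
  simp only [hγ, add_sub_cancel_left, smul_smul]
  rw [inv_mul_cancel₀ (by linarith)]
  simp

theorem IsFacet.subset_frontier {P F : Set V} (hF : IsFacet P F) : F ⊆ frontier P := by
  obtain ⟨⟨f, c, hf, hle, rfl⟩, -, -⟩ := hF
  intro x hx
  refine ⟨subset_closure hx.1, fun hint => ?_⟩
  exact absurd hx.2 (interior_lt_of_forall_le hf hle hint).ne

end Cover

/-! ### Finite energy implies finite entropy. -/

namespace HamiltonianTriple

variable {V : Type*} [NormedAddCommGroup V] [NormedSpace ℝ V] [MeasurableSpace V]

/-- The integral of `u log u + 1 - u`. -/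
noncomputable def klInt (H : HamiltonianTriple V) (u : V → ℝ≥0∞) : ℝ≥0∞ :=
  ∫⁻ x in H.P, ENNReal.ofReal (InformationTheory.klFun (u x).toReal) ∂H.μ

/-- The properties of a system that are inherited by composites and do not involve facets. -/
structure IsTame (H : HamiltonianTriple V) : Prop where
  compact : IsCompact H.P
  convex : Convex ℝ H.P
  interior_nonempty : (interior H.P).Nonempty
  flat : IsFlatMeasure H.P H.μ
  finite_boundary : IsFiniteMeasure H.σ
  carried : H.σ (frontier H.P)ᶜ = 0

section

variable [BorelSpace V] {H : HamiltonianTriple V}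

theorem IsSystem.isTame [FiniteDimensional ℝ V] (h : H.IsSystem) : H.IsTame where
  compact := h.simple.1.1
  convex := h.simple.1.convex
  interior_nonempty := h.simple.1.2.1
  flat := h.flat
  finite_boundary := h.flat_boundary.isFiniteMeasure h.simple.1
  carried := h.flat_boundary.1

theorem IsTame.restrict_eq (h : H.IsTame) : H.μ.restrict H.P = H.μ := by
  obtain ⟨m, -, hm⟩ := h.flat
  rw [hm, Measure.restrict_restrict h.compact.measurableSet, inter_self]

omit [BorelSpace V] in
theorem IsTame.isFiniteMeasure (h : H.IsTame) : IsFiniteMeasure H.μ := by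
  obtain ⟨m, hm, hm'⟩ := h.flat
  refine ⟨?_⟩
  rw [hm', Measure.restrict_apply_univ]
  exact h.compact.measure_lt_top

theorem IsTame.measure_interior_pos (h : H.IsTame) : 0 < H.μ (interior H.P) := by
  obtain ⟨m, hm, hm'⟩ := h.flat
  rw [hm', Measure.restrict_apply isOpen_interior.measurableSet,
    inter_eq_left.2 interior_subset]
  exact isOpen_interior.measure_pos m h.interior_nonempty

theorem IsTame.measure_pos (h : H.IsTame) : 0 < H.μ H.P :=
  h.measure_interior_pos.trans_le (measure_mono interior_subset)

omit [BorelSpace V] in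
theorem IsTame.measure_ne_top (h : H.IsTame) : H.μ H.P ≠ ∞ := by
  have := h.isFiniteMeasure
  exact _root_.MeasureTheory.measure_ne_top _ _

theorem IsTame.aemeasurable (h : H.IsTame) {u : V → ℝ≥0∞} (hu : H.IsState u) :
    AEMeasurable u (H.μ.restrict H.P) :=
  hu.lsc.aemeasurable_restrict h.compact.isClosed _

theorem IsTame.ae_lt_top (h : H.IsTame) {u : V → ℝ≥0∞} (hu : H.IsState u) :
    ∀ᵐ x ∂H.μ.restrict H.P, u x < ∞ := by
  refine ae_lt_top' (h.aemeasurable hu) ?_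
  rw [hu.normalized]; exact h.measure_ne_top

theorem IsTame.exists_interior_ne_top (h : H.IsTame) {u : V → ℝ≥0∞} (hu : H.IsState u) :
    ∃ x ∈ interior H.P, u x ≠ ∞ := by
  by_contra! hcon
  have h1 := h.ae_lt_top hu
  rw [h.restrict_eq] at h1
  have h2 : H.μ (interior H.P) = 0 := by
    refine measure_mono_null (fun x hx => ?_) (ae_iff.1 h1)
    show ¬ (u x < ∞)
    simp [hcon x hx]
  exact h.measure_interior_pos.ne' h2

omit [BorelSpace V] in
theorem IsTame.restrict_frontier_eq (h : H.IsTame) : H.σ.restrict (frontier H.P) = H.σ := by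
  refine Measure.restrict_eq_self_of_ae_mem ?_
  rw [ae_iff]; exact h.carried

theorem energy_ne_top_iff (h : H.IsTame) {u : V → ℝ≥0∞} :
    H.energy u ≠ ⊤ ↔ ∫⁻ x in frontier H.P, u x ∂H.σ ≠ ∞ := by
  unfold energy
  rw [Ne, EReal.coe_ennreal_eq_top_iff, ENNReal.div_eq_top]
  simp [h.measure_pos.ne', h.measure_ne_top]

/-- A state of finite energy has finite entropy. -/
theorem IsSystem.klInt_ne_top [FiniteDimensional ℝ V] (hS : H.IsSystem) {u : V → ℝ≥0∞}
    (hu : H.IsState u) (hE : H.energy u ≠ ⊤) : H.klInt u ≠ ∞ := by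
  classical
  have h := hS.isTame
  rw [energy_ne_top_iff h] at hE
  obtain ⟨x₀, hx₀, hux₀⟩ := h.exists_interior_ne_top hu
  have hx₀P := interior_subset hx₀
  have hfin := h.finite_boundary
  obtain ⟨m, hm, hμ⟩ := h.flat
  obtain ⟨T, hT, hTF, hcov⟩ := hS.simple.1.frontier_subset_facets
  set g : V → ℝ≥0∞ := fun x =>
    ENNReal.ofReal (InformationTheory.klFun (H.P.piecewise u (fun _ => ∞) x).toReal) with hg
  have hgm : Measurable g := ENNReal.measurable_ofReal.comp
    (InformationTheory.measurable_klFun.comp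
      (hu.lsc.measurable_piecewise_top h.compact.isClosed).ennreal_toReal)
  have hkl : H.klInt u = ∫⁻ x in H.P, g x ∂m := by
    unfold klInt
    rw [h.restrict_eq, hμ]
    refine setLIntegral_congr_fun h.compact.measurableSet fun x hx => ?_
    simp only [hg, piecewise_eq_of_mem _ _ _ hx]
  set K : Set V → Set V :=
    fun F => (fun q : V × ℝ => x₀ + q.2 • (q.1 - x₀)) '' (F ×ˢ Icc 0 1) with hK
  have hsub : H.P ⊆ {x₀} ∪ ⋃ F ∈ T, K F := by
    intro x hx
    by_cases hxx : x = x₀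
    · exact Or.inl hxx
    · obtain ⟨y, hy, r, hr, hxr⟩ := exists_frontier_of_mem h.compact.isBounded hx hxx
      obtain ⟨F, hF, hyF⟩ := hcov hy
      exact Or.inr (mem_biUnion hF ⟨(y, r), ⟨hyF, hr.1.le, hr.2⟩, hxr⟩)
  -- The integral over the segment ending at `y ∈ F` is at most `c * (u y + 1)`, and `u` is
  -- integrable over the facet because the energy is finite.
  have hcone : ∀ F ∈ T, ∫⁻ x in K F, g x ∂m ≠ ∞ := by
    intro F hF
    obtain ⟨C, hC, hle⟩ := lintegral_cone_le h.compact (hTF F hF) hx₀ m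
      (hS.flat_boundary.2 F (hTF F hF))
    refine ne_top_of_le_ne_top ?_ (hle g hgm)
    refine ENNReal.mul_ne_top hC ?_
    have hFfr := (hTF F hF).subset_frontier
    have hFP : F ⊆ H.P := hFfr.trans h.compact.isClosed.frontier_subset
    have hFm := ((hTF F hF).isCompact h.compact).measurableSet
    set c := ENNReal.ofReal (max (u x₀).toReal 1 * Real.log (max (u x₀).toReal 1) +
      max (u x₀).toReal 1 + 1) with hc
    have hbound : ∀ y ∈ F, ∫⁻ r in Ioc (0 : ℝ) 1, g (x₀ + r • (y - x₀)) ≤ c * (u y + 1) := by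
      intro y hy
      have hseg : ∀ r : ℝ, x₀ + r • (y - x₀) = (1 - r) • x₀ + r • y := fun r => by module
      refine lintegral_klFun_le hux₀ fun r hr => ?_
      have hmem : x₀ + r • (y - x₀) ∈ H.P := by
        rw [hseg]
        exact h.convex hx₀P (hFP hy) (by linarith [hr.2]) hr.1.le (by ring)
      rw [piecewise_eq_of_mem _ _ _ hmem, hseg]
      exact hu.logConvex x₀ hx₀P y (hFP hy) r hr.1.le hr.2
    refine ne_top_of_le_ne_top ?_ (setLIntegral_mono' hFm hbound)
    rw [lintegral_const_mul' _ _ ENNReal.ofReal_ne_top, lintegral_add_right _ measurable_const]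
    refine ENNReal.mul_ne_top ENNReal.ofReal_ne_top (ENNReal.add_ne_top.2 ⟨?_, ?_⟩)
    · exact ne_top_of_le_ne_top hE (lintegral_mono_set hFfr)
    · simp
  rw [hkl]
  refine ne_top_of_le_ne_top ?_ (lintegral_mono_set hsub)
  refine ne_top_of_le_ne_top ?_ (lintegral_union_le _ _ _)
  refine ENNReal.add_ne_top.2 ⟨?_, ?_⟩
  · rw [lintegral_singleton]
    exact ENNReal.mul_ne_top ENNReal.ofReal_ne_top isCompact_singleton.measure_lt_top.ne
  · rw [biUnion_eq_iUnion]
    have : Finite T := hT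
    have : Fintype T := Fintype.ofFinite T
    refine ne_top_of_le_ne_top ?_ (lintegral_iUnion_le _ _)
    rw [tsum_fintype]
    exact ENNReal.sum_ne_top.2 fun F _ => hcone F F.2

end

end HamiltonianTriple

/-! ### Entropy as an integral of `klFun`, and concavity of the equilibrium entropy. -/

namespace HamiltonianTriple

variable {V : Type*} [NormedAddCommGroup V] [NormedSpace ℝ V] [MeasurableSpace V]

theorem mulLog_of_ne_top {a : ℝ≥0∞} (ha : a ≠ ∞) :
    mulLog a = ((a.toReal * Real.log a.toReal : ℝ) : EReal) := by
  unfold mulLog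
  by_cases h0 : a = 0
  · simp [h0]
  · rw [ENNReal.log_pos_real h0 ha, EReal.coe_mul, EReal.coe_ennreal_toReal ha]

/-- This is `a log a + 1 = klFun a + a` with the negative part moved across, so that it can be
integrated in `ℝ≥0∞` without finiteness assumptions. -/
theorem toENNReal_mulLog_add_one {a : ℝ≥0∞} (ha : a ≠ ∞) :
    (mulLog a).toENNReal + 1 =
      ENNReal.ofReal (InformationTheory.klFun a.toReal) + a + (-mulLog a).toENNReal := by
  have hx : 0 ≤ a.toReal := ENNReal.toReal_nonneg
  have hk := InformationTheory.klFun_nonneg hx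
  rw [mulLog_of_ne_top ha, ← EReal.coe_neg, EReal.real_coe_toENNReal, EReal.real_coe_toENNReal]
  conv_rhs => enter [1, 2]; rw [← ENNReal.ofReal_toReal ha]
  rw [← ENNReal.ofReal_add hk hx]
  rw [InformationTheory.klFun_apply] at hk ⊢
  rcases le_total 0 (a.toReal * Real.log a.toReal) with h | h
  · rw [ENNReal.ofReal_of_nonpos (neg_nonpos.2 h), add_zero, ← ENNReal.ofReal_one,
      ← ENNReal.ofReal_add h zero_le_one]
    congr 1; ring
  · rw [ENNReal.ofReal_of_nonpos h, zero_add, ← ENNReal.ofReal_add (by linarith) (by linarith),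
      ← ENNReal.ofReal_one]
    congr 1; ring

theorem toENNReal_neg_mulLog_le {a : ℝ≥0∞} (ha : a ≠ ∞) : (-mulLog a).toENNReal ≤ 1 := by
  have hk := InformationTheory.klFun_nonneg (x := a.toReal) ENNReal.toReal_nonneg
  rw [InformationTheory.klFun_apply] at hk
  rw [mulLog_of_ne_top ha, ← EReal.coe_neg, EReal.real_coe_toENNReal, ENNReal.ofReal_le_one]
  by_cases h : a.toReal ≤ 1
  · linarith [ENNReal.toReal_nonneg (a := a)]
  · have := mul_nonneg (ENNReal.toReal_nonneg (a := a)) (Real.log_nonneg (not_le.1 h).le)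
    linarith

section

variable [BorelSpace V] {H : HamiltonianTriple V}

/-- The normalization makes the integral of `1 - u` vanish, so `u log u` may be replaced by the
nonnegative `klFun`. Only finite quantities are cancelled (the negative part and the total mass), so
the case of infinite `klInt` is included. -/
theorem IsTame.entropy_eq (h : H.IsTame) {u : V → ℝ≥0∞} (hu : H.IsState u) :
    H.entropy u = -((H.klInt u : EReal) / ((H.μ H.P : ℝ≥0∞) : EReal)) := by
  have hum := h.aemeasurable hu
  have hfin := h.ae_lt_top hu
  have hkm : AEMeasurable (fun x => ENNReal.ofReal (InformationTheory.klFun (u x).toReal))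
      (H.μ.restrict H.P) := ENNReal.measurable_ofReal.comp_aemeasurable
    (InformationTheory.measurable_klFun.comp_aemeasurable hum.ennreal_toReal)
  have hBm : AEMeasurable (fun x => (-mulLog (u x)).toENNReal) (H.μ.restrict H.P) := by
    have : AEMeasurable (fun x => ENNReal.ofReal (-((u x).toReal * Real.log (u x).toReal)))
        (H.μ.restrict H.P) := ENNReal.measurable_ofReal.comp_aemeasurable
      (hum.ennreal_toReal.mul (Real.measurable_log.comp_aemeasurable hum.ennreal_toReal)).neg
    refine this.congr ?_
    filter_upwards [hfin] with x hx
    rw [mulLog_of_ne_top hx.ne, ← EReal.coe_neg, EReal.real_coe_toENNReal]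
  set A := ∫⁻ x in H.P, (mulLog (u x)).toENNReal ∂H.μ with hA
  set B := ∫⁻ x in H.P, (-mulLog (u x)).toENNReal ∂H.μ with hB
  have hBN : B ≤ H.μ H.P := by
    calc B ≤ ∫⁻ x in H.P, 1 ∂H.μ := lintegral_mono_ae (by
          filter_upwards [hfin] with x hx using toENNReal_neg_mulLog_le hx.ne)
      _ = H.μ H.P := by simp
  have hBtop : B ≠ ∞ := ne_top_of_le_ne_top h.measure_ne_top hBN
  have hAB : A + H.μ H.P = H.klInt u + B + H.μ H.P := by
    have h1 : ∫⁻ x in H.P, ((mulLog (u x)).toENNReal + 1) ∂H.μ = ∫⁻ x in H.P,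
        (ENNReal.ofReal (InformationTheory.klFun (u x).toReal) + u x +
          (-mulLog (u x)).toENNReal) ∂H.μ := lintegral_congr_ae (by
      filter_upwards [hfin] with x hx using toENNReal_mulLog_add_one hx.ne)
    rw [lintegral_add_right _ measurable_const, lintegral_add_right' _ hBm,
      lintegral_add_left' hkm, hu.normalized] at h1
    simp only [lintegral_const, one_mul, Measure.restrict_apply_univ] at h1
    rw [h1, klInt, add_right_comm]
  have hA' : A = H.klInt u + B := (ENNReal.add_left_inj h.measure_ne_top).1 hAB
  have hsub : (A : EReal) - (B : EReal) = (H.klInt u : EReal) := by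
    rw [hA', EReal.coe_ennreal_add, ← EReal.coe_ennreal_toReal hBtop,
      EReal.add_sub_cancel_right]
  unfold entropy
  rw [← hA, ← hB, hsub]

theorem IsTame.entropy_eq_coe (h : H.IsTame) {u : V → ℝ≥0∞} (hu : H.IsState u)
    (hk : H.klInt u ≠ ∞) :
    H.entropy u = ((-((H.klInt u).toReal / (H.μ H.P).toReal) : ℝ) : EReal) := by
  rw [h.entropy_eq hu, EReal.coe_neg, EReal.coe_div, EReal.coe_ennreal_toReal hk,
    EReal.coe_ennreal_toReal h.measure_ne_top]

theorem IsTame.measure_toReal_pos (h : H.IsTame) : 0 < (H.μ H.P).toReal :=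
  ENNReal.toReal_pos h.measure_pos.ne' h.measure_ne_top

theorem IsTame.entropy_eq_bot (h : H.IsTame) {u : V → ℝ≥0∞} (hu : H.IsState u)
    (hk : H.klInt u = ∞) : H.entropy u = ⊥ := by
  rw [h.entropy_eq hu, hk, ← EReal.coe_ennreal_toReal h.measure_ne_top, EReal.coe_ennreal_top,
    EReal.top_div_of_pos_ne_top (by exact_mod_cast h.measure_toReal_pos) (EReal.coe_ne_top _),
    EReal.neg_top]

theorem IsTame.entropy_nonpos (h : H.IsTame) {u : V → ℝ≥0∞} (hu : H.IsState u) :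
    H.entropy u ≤ 0 := by
  by_cases hk : H.klInt u = ∞
  · rw [h.entropy_eq_bot hu hk]; exact bot_le
  · rw [h.entropy_eq_coe hu hk]
    have : 0 ≤ (H.klInt u).toReal / (H.μ H.P).toReal := by positivity
    exact_mod_cast neg_nonpos.2 this

theorem IsTame.eqEntropy_nonpos (h : H.IsTame) (U : ℝ) : H.eqEntropy U ≤ 0 := by
  refine sSup_le ?_
  rintro _ ⟨u, hu, rfl⟩
  exact h.entropy_nonpos hu.1

omit [BorelSpace V] in
theorem entropy_le_eqEntropy {u : V → ℝ≥0∞} {U : ℝ} (hu : H.IsState u) (hU : H.energy u = U) :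
    H.entropy u ≤ H.eqEntropy U := le_sSup ⟨u, ⟨hu, hU⟩, rfl⟩

theorem IsTame.energy_eq_coe (h : H.IsTame) {u : V → ℝ≥0∞}
    (hE : ∫⁻ x in frontier H.P, u x ∂H.σ ≠ ∞) :
    H.energy u =
      (((∫⁻ x in frontier H.P, u x ∂H.σ).toReal / (H.μ H.P).toReal : ℝ) : EReal) := by
  unfold energy
  rw [← EReal.coe_ennreal_toReal (ENNReal.div_ne_top hE h.measure_pos.ne'), ENNReal.toReal_div]

omit [BorelSpace V] in
theorem isState_one : H.IsState fun _ => 1 where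
  pos _ _ := one_pos
  lsc := lowerSemicontinuousOn_const
  logConvex _ _ _ _ t _ _ := by simp
  normalized := by simp

theorem IsTame.exists_eqEntropy_one (h : H.IsTame) :
    ∃ E : ℝ, H.energy (fun _ => 1) = E ∧ H.eqEntropy E = 0 := by
  have := h.finite_boundary
  have hE : ∫⁻ x in frontier H.P, 1 ∂H.σ ≠ ∞ := by simp
  refine ⟨_, h.energy_eq_coe hE, le_antisymm (h.eqEntropy_nonpos _) ?_⟩
  have hs := isState_one (H := H)
  have hk : H.klInt (fun _ => 1) = 0 := by
    simp [klInt, InformationTheory.klFun_one]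
  have := entropy_le_eqEntropy hs (h.energy_eq_coe hE)
  rwa [h.entropy_eq_coe hs (by simp [hk]), hk, ENNReal.toReal_zero, zero_div, neg_zero] at this

/-- A state of entropy zero is bounded below by one. -/
theorem IsTame.one_le_of_klInt_eq_zero (h : H.IsTame) [FiniteDimensional ℝ V] {u : V → ℝ≥0∞}
    (hu : H.IsState u) (hk : H.klInt u = 0) {x : V} (hx : x ∈ H.P) : 1 ≤ u x := by
  obtain ⟨m, hm, hμ⟩ := h.flat
  have hum := h.aemeasurable hu
  have hkm : AEMeasurable (fun x => ENNReal.ofReal (InformationTheory.klFun (u x).toReal))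
      (H.μ.restrict H.P) := ENNReal.measurable_ofReal.comp_aemeasurable
    (InformationTheory.measurable_klFun.comp_aemeasurable hum.ennreal_toReal)
  have hone : ∀ᵐ z ∂m, z ∈ H.P → u z = 1 := by
    rw [← ae_restrict_iff' h.compact.measurableSet, ← hμ, ← h.restrict_eq]
    rw [klInt, lintegral_eq_zero_iff' hkm] at hk
    filter_upwards [hk, h.ae_lt_top hu] with z hz hz'
    have h1 : InformationTheory.klFun (u z).toReal = 0 :=
      le_antisymm (ENNReal.ofReal_eq_zero.1 hz)
        (InformationTheory.klFun_nonneg ENNReal.toReal_nonneg)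
    rw [InformationTheory.klFun_eq_zero_iff ENNReal.toReal_nonneg] at h1
    rw [← ENNReal.ofReal_toReal hz'.ne, h1, ENNReal.ofReal_one]
  -- The contraction `z ↦ (x + z) / 2` preserves null sets under preimage, so `u = 1` holds at
  -- almost all midpoints as well.
  have hmid : ∀ᵐ z ∂m, (1 - (1 / 2 : ℝ)) • x + (1 / 2 : ℝ) • z ∈ H.P →
      u ((1 - (1 / 2 : ℝ)) • x + (1 / 2 : ℝ) • z) = 1 := by
    have hq : Measure.QuasiMeasurePreserving
        (fun z : V => (1 - (1 / 2 : ℝ)) • x + (1 / 2 : ℝ) • z) m m := by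
      refine ⟨by fun_prop, ?_⟩
      have : m.map (fun z : V => (1 - (1 / 2 : ℝ)) • x + (1 / 2 : ℝ) • z) =
          (m.map ((1 / 2 : ℝ) • ·)).map ((1 - (1 / 2 : ℝ)) • x + ·) := by
        rw [Measure.map_map (by fun_prop) (by fun_prop)]; rfl
      rw [this, Measure.map_addHaar_smul m (by norm_num), Measure.map_smul, map_add_left_eq_self]
      exact Measure.smul_absolutelyContinuous
    exact hq.ae hone
  have hpos : (m.restrict (interior H.P)) ≠ 0 := by
    rw [Ne, Measure.restrict_eq_zero]
    exact (isOpen_interior.measure_pos m h.interior_nonempty).ne'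
  have hne : (ae (m.restrict (interior H.P))).NeBot := ae_neBot.2 hpos
  obtain ⟨z, hz1, hz2, hz3⟩ := ((ae_restrict_of_ae (s := interior H.P) hone).and
    ((ae_restrict_of_ae (s := interior H.P) hmid).and
      (ae_restrict_mem isOpen_interior.measurableSet))).exists
  have hzP := interior_subset hz3
  -- With value `1` at `z` and at the midpoint, log convexity reads `1 ≤ u x ^ (1 / 2)`.
  have hc := hu.logConvex x hx z hzP (1 / 2) (by norm_num) (by norm_num)
  rw [hz1 hzP, hz2 (h.convex hx hzP (by norm_num) (by norm_num) (by norm_num)),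
    ENNReal.one_rpow, mul_one] at hc
  by_contra! hlt
  exact absurd (ENNReal.rpow_lt_one hlt (by norm_num)) (not_lt.2 hc)

/-- The convex combination of two functions. -/
noncomputable def mix (t : ℝ) (u v : V → ℝ≥0∞) : V → ℝ≥0∞ :=
  fun x => ENNReal.ofReal (1 - t) * u x + ENNReal.ofReal t * v x

/-- Hölder's inequality on a two-point space with masses `a` and `b`. It says that positive
combinations of log convex functions are log convex. -/
theorem rpow_mul_rpow_mix_le (a b x₁ x₂ y₁ y₂ : ℝ≥0∞) {p q : ℝ} (hp : 0 ≤ p) (hq : 0 ≤ q)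
    (hpq : p + q = 1) :
    a * (x₁ ^ p * y₁ ^ q) + b * (x₂ ^ p * y₂ ^ q) ≤
      (a * x₁ + b * x₂) ^ p * (a * y₁ + b * y₂) ^ q := by
  have h := ENNReal.lintegral_mul_norm_pow_le
    (μ := a • Measure.dirac true + b • Measure.dirac false)
    (f := fun c : Bool => if c then x₁ else x₂) (g := fun c : Bool => if c then y₁ else y₂)
    (measurable_of_finite _).aemeasurable (measurable_of_finite _).aemeasurable hp hq hpq
  simpa [lintegral_add_measure, lintegral_smul_measure, lintegral_dirac] using h

theorem IsTame.isState_mix (h : H.IsTame) {u v : V → ℝ≥0∞} (hu : H.IsState u) (hv : H.IsState v)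
    {t : ℝ} (ht0 : 0 < t) (ht1 : t < 1) : H.IsState (mix t u v) where
  pos x hx := by
    have h1 : 0 < ENNReal.ofReal (1 - t) * u x :=
      ENNReal.mul_pos (by simpa using ht1) (hu.pos x hx).ne'
    exact h1.trans_le le_self_add
  lsc := by
    have hc : ∀ (c : ℝ≥0∞) (w : V → ℝ≥0∞), c ≠ ∞ → LowerSemicontinuousOn w H.P →
        LowerSemicontinuousOn (fun x => c * w x) H.P := fun c w hc hw =>
      (ENNReal.continuous_const_mul hc).comp_lowerSemicontinuousOn hw
        fun a b hab => mul_le_mul_right hab c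
    exact (hc _ _ ENNReal.ofReal_ne_top hu.lsc).add (hc _ _ ENNReal.ofReal_ne_top hv.lsc)
  logConvex x hx y hy s hs0 hs1 := by
    refine le_trans ?_ (rpow_mul_rpow_mix_le _ _ _ _ _ _ (by linarith) hs0 (by ring))
    exact add_le_add (mul_le_mul_right (hu.logConvex x hx y hy s hs0 hs1) _)
      (mul_le_mul_right (hv.logConvex x hx y hy s hs0 hs1) _)
  normalized := by
    unfold mix
    rw [lintegral_add_left' ((h.aemeasurable hu).const_mul _),
      lintegral_const_mul' _ _ ENNReal.ofReal_ne_top,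
      lintegral_const_mul' _ _ ENNReal.ofReal_ne_top, hu.normalized, hv.normalized, ← add_mul,
      ← ENNReal.ofReal_add (by linarith) ht0.le]
    simp

theorem IsTame.aemeasurable_frontier (h : H.IsTame) {u : V → ℝ≥0∞} (hu : H.IsState u) :
    AEMeasurable u (H.σ.restrict (frontier H.P)) :=
  (hu.lsc.aemeasurable_restrict h.compact.isClosed H.σ).mono_measure
    (Measure.restrict_mono h.compact.isClosed.frontier_subset le_rfl)

theorem IsTame.lintegral_frontier_mix (h : H.IsTame) {u v : V → ℝ≥0∞} (hu : H.IsState u)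
    (t : ℝ) :
    ∫⁻ x in frontier H.P, mix t u v x ∂H.σ =
      ENNReal.ofReal (1 - t) * ∫⁻ x in frontier H.P, u x ∂H.σ +
        ENNReal.ofReal t * ∫⁻ x in frontier H.P, v x ∂H.σ := by
  unfold mix
  rw [lintegral_add_left' ((h.aemeasurable_frontier hu).const_mul _),
    lintegral_const_mul' _ _ ENNReal.ofReal_ne_top,
    lintegral_const_mul' _ _ ENNReal.ofReal_ne_top]

theorem IsTame.klInt_mix_le (h : H.IsTame) {u v : V → ℝ≥0∞} (hu : H.IsState u) (hv : H.IsState v)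
    {t : ℝ} (ht0 : 0 < t) (ht1 : t < 1) :
    H.klInt (mix t u v) ≤ ENNReal.ofReal (1 - t) * H.klInt u + ENNReal.ofReal t * H.klInt v := by
  have hkm : AEMeasurable (fun x => ENNReal.ofReal (InformationTheory.klFun (u x).toReal))
      (H.μ.restrict H.P) := ENNReal.measurable_ofReal.comp_aemeasurable
    (InformationTheory.measurable_klFun.comp_aemeasurable (h.aemeasurable hu).ennreal_toReal)
  unfold klInt
  rw [← lintegral_const_mul' _ _ ENNReal.ofReal_ne_top,
    ← lintegral_const_mul' _ _ ENNReal.ofReal_ne_top, ← lintegral_add_left' (hkm.const_mul _)]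
  refine lintegral_mono_ae ?_
  filter_upwards [h.ae_lt_top hu, h.ae_lt_top hv] with x hx hy
  have h1t : 0 ≤ 1 - t := by linarith
  have hk := InformationTheory.convexOn_klFun.2
    (mem_Ici.2 (ENNReal.toReal_nonneg (a := u x))) (mem_Ici.2 (ENNReal.toReal_nonneg (a := v x)))
    h1t ht0.le (by ring)
  have hmix : (mix t u v x).toReal = (1 - t) • (u x).toReal + t • (v x).toReal := by
    unfold mix
    rw [ENNReal.toReal_add (ENNReal.mul_ne_top ENNReal.ofReal_ne_top hx.ne)
      (ENNReal.mul_ne_top ENNReal.ofReal_ne_top hy.ne), ENNReal.toReal_mul, ENNReal.toReal_mul,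
      ENNReal.toReal_ofReal h1t, ENNReal.toReal_ofReal ht0.le]
    rfl
  have hk1 := InformationTheory.klFun_nonneg (ENNReal.toReal_nonneg (a := u x))
  have hk2 := InformationTheory.klFun_nonneg (ENNReal.toReal_nonneg (a := v x))
  rw [hmix, ← ENNReal.ofReal_mul h1t, ← ENNReal.ofReal_mul ht0.le,
    ← ENNReal.ofReal_add (mul_nonneg h1t hk1) (mul_nonneg ht0.le hk2)]
  exact ENNReal.ofReal_le_ofReal hk

theorem IsTame.exists_state_of_lt (h : H.IsTame) {U s : ℝ} (hs : (s : EReal) < H.eqEntropy U) :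
    ∃ u, H.IsState u ∧ H.energy u = U ∧ ∫⁻ x in frontier H.P, u x ∂H.σ ≠ ∞ ∧
      H.klInt u ≠ ∞ ∧ (s : EReal) < H.entropy u := by
  obtain ⟨_, ⟨u, ⟨hu, hU⟩, rfl⟩, hlt⟩ := lt_sSup_iff.1 hs
  refine ⟨u, hu, hU, ?_, ?_, hlt⟩
  · rw [← energy_ne_top_iff h, hU]; exact EReal.coe_ne_top _
  · intro hk
    rw [h.entropy_eq_bot hu hk] at hlt
    exact not_lt_bot hlt

/-- The equilibrium entropy is concave. -/
theorem IsTame.eqEntropy_concave (h : H.IsTame) {U W s r t : ℝ} (ht0 : 0 < t) (ht1 : t < 1)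
    (hs : (s : EReal) < H.eqEntropy U) (hr : (r : EReal) < H.eqEntropy W) :
    (((1 - t) * s + t * r : ℝ) : EReal) ≤ H.eqEntropy ((1 - t) * U + t * W) := by
  obtain ⟨u, hu, hU, hEu, hku, hsu⟩ := h.exists_state_of_lt hs
  obtain ⟨w, hw, hW, hEw, hkw, hrw⟩ := h.exists_state_of_lt hr
  have hN := h.measure_toReal_pos
  have h1t : 0 ≤ 1 - t := by linarith
  have hm := h.isState_mix hu hw ht0 ht1
  have hEm := h.lintegral_frontier_mix (v := w) hu t
  have hE1 := ENNReal.mul_ne_top (ENNReal.ofReal_ne_top (r := 1 - t)) hEu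
  have hE2 := ENNReal.mul_ne_top (ENNReal.ofReal_ne_top (r := t)) hEw
  have hk1 := ENNReal.mul_ne_top (ENNReal.ofReal_ne_top (r := 1 - t)) hku
  have hk2 := ENNReal.mul_ne_top (ENNReal.ofReal_ne_top (r := t)) hkw
  have hkm := h.klInt_mix_le hu hw ht0 ht1
  have hkt : H.klInt (mix t u w) ≠ ∞ := ne_top_of_le_ne_top (ENNReal.add_ne_top.2 ⟨hk1, hk2⟩) hkm
  have hen : H.energy (mix t u w) = (((1 - t) * U + t * W : ℝ) : EReal) := by
    rw [h.energy_eq_coe (by rw [hEm]; exact ENNReal.add_ne_top.2 ⟨hE1, hE2⟩), hEm,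
      ENNReal.toReal_add hE1 hE2, ENNReal.toReal_mul, ENNReal.toReal_mul,
      ENNReal.toReal_ofReal h1t, ENNReal.toReal_ofReal ht0.le]
    rw [h.energy_eq_coe hEu] at hU
    rw [h.energy_eq_coe hEw] at hW
    rw [← EReal.coe_injective hU, ← EReal.coe_injective hW]
    congr 1; ring
  refine le_trans ?_ (entropy_le_eqEntropy hm hen)
  rw [h.entropy_eq_coe hm hkt, EReal.coe_le_coe_iff]
  rw [h.entropy_eq_coe hu hku, EReal.coe_lt_coe_iff] at hsu
  rw [h.entropy_eq_coe hw hkw, EReal.coe_lt_coe_iff] at hrw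
  have hle : (H.klInt (mix t u w)).toReal ≤
      (1 - t) * (H.klInt u).toReal + t * (H.klInt w).toReal := by
    have := ENNReal.toReal_mono (ENNReal.add_ne_top.2 ⟨hk1, hk2⟩) hkm
    rwa [ENNReal.toReal_add hk1 hk2, ENNReal.toReal_mul, ENNReal.toReal_mul,
      ENNReal.toReal_ofReal h1t, ENNReal.toReal_ofReal ht0.le] at this
  have hdiv := div_le_div_of_nonneg_right hle hN.le
  rw [add_div, mul_div_assoc, mul_div_assoc] at hdiv
  nlinarith [mul_le_mul_of_nonneg_left hsu.le h1t, mul_le_mul_of_nonneg_left hrw.le ht0.le]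

/-- The equilibrium entropy at an equilibrium of energy below that of the constant state. -/
theorem IsTame.eqEntropy_of_isEquilibrium [FiniteDimensional ℝ V] (h : H.IsTame)
    (hfin : ∀ u, H.IsState u → H.energy u ≠ ⊤ → H.klInt u ≠ ∞) {U : ℝ}
    (hU : U ∈ H.energyInterval) {u : V → ℝ≥0∞} (hu : H.IsEquilibrium U u) :
    H.eqEntropy U = H.entropy u ∧ (∃ s : ℝ, s < 0 ∧ H.entropy u = s) ∧
      ∃ E : ℝ, U < E ∧ H.eqEntropy E = 0 := by
  obtain ⟨E, hE, hE0⟩ := h.exists_eqEntropy_one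
  have hUE := hU.2
  have hne : H.energy u ≠ ⊤ := by rw [hu.1.2]; exact EReal.coe_ne_top _
  have hk := hfin u hu.1.1 hne
  refine ⟨le_antisymm (sSup_le ?_) (entropy_le_eqEntropy hu.1.1 hu.1.2), ⟨_, ?_,
    h.entropy_eq_coe hu.1.1 hk⟩, E, ?_, hE0⟩
  · rintro _ ⟨v, hv, rfl⟩
    exact hu.2 v hv
  · rw [neg_lt_zero]
    refine div_pos (ENNReal.toReal_pos (fun h0 => ?_) hk) h.measure_toReal_pos
    -- Entropy zero would force `u ≥ 1` on all of `P`, boundary included, hence an energy at least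
    -- that of the constant state.
    rw [← hu.1.2] at hUE
    refine absurd hUE (not_lt.2 ?_)
    unfold energy
    rw [EReal.coe_ennreal_le_coe_ennreal_iff]
    refine ENNReal.div_le_div_right ?_ _
    exact setLIntegral_mono' measurableSet_frontier fun x hx =>
      h.one_le_of_klInt_eq_zero hu.1.1 h0 (h.compact.isClosed.frontier_subset hx)
  · rw [hE] at hUE
    exact_mod_cast hUE

end

end HamiltonianTriple

/-! ### Lower semicontinuity of products and of partial integrals. -/

theorem LowerSemicontinuousOn.ennreal_mul {X : Type*} [TopologicalSpace X] {s : Set X}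
    {f g : X → ℝ≥0∞} (hf : LowerSemicontinuousOn f s) (hg : LowerSemicontinuousOn g s) :
    LowerSemicontinuousOn (fun x => f x * g x) s := by
  intro x hx a ha
  change a < f x * g x at ha
  change ∀ᶠ y in 𝓝[s] x, a < f y * g y
  -- Multiplication on `[0, ∞]` is discontinuous at `(0, ∞)`, but products can be approximated from
  -- below by products of smaller factors.
  obtain ⟨b, hb, c, hc, habc⟩ : ∃ b < f x, ∃ c < g x, a < b * c := by
    by_contra! hcon
    exact absurd (ENNReal.mul_le_of_forall_lt hcon) (not_le.2 ha)
  filter_upwards [hf x hx b hb, hg x hx c hc] with y hy1 hy2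
  exact habc.trans_le (mul_le_mul' (le_of_lt hy1) (le_of_lt hy2))

/-- Fatou's lemma, applied along the neighbourhood filter of `x`, which is countably generated. -/
theorem LowerSemicontinuous.lintegral_prodMk {X Y : Type*} [TopologicalSpace X]
    [FirstCountableTopology X] [TopologicalSpace Y] [MeasurableSpace Y] [BorelSpace Y]
    {u : X × Y → ℝ≥0∞} (hu : LowerSemicontinuous u) (μ : Measure Y) :
    LowerSemicontinuous fun x => ∫⁻ y, u (x, y) ∂μ := by
  rw [lowerSemicontinuous_iff_le_liminf]
  intro x
  refine le_trans (lintegral_mono fun y => ?_) (lintegral_liminf_le fun x' =>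
    (hu.comp (Continuous.prodMk_right x')).measurable)
  exact (hu.comp (Continuous.prodMk_left y)).le_liminf x

/-! ### Entropy as a Bochner integral of `u log u`. -/

namespace HamiltonianTriple

section MulLog

variable {V : Type*} [NormedAddCommGroup V] [NormedSpace ℝ V] [MeasurableSpace V] [BorelSpace V]
  {H : HamiltonianTriple V}

theorem IsTame.lintegral_eq (h : H.IsTame) {u : V → ℝ≥0∞} (hu : H.IsState u) :
    ∫⁻ x, u x ∂H.μ = H.μ H.P := by
  rw [← hu.normalized, h.restrict_eq]

theorem IsTame.aemeasurable' (h : H.IsTame) {u : V → ℝ≥0∞} (hu : H.IsState u) :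
    AEMeasurable u H.μ := by
  have := h.aemeasurable hu
  rwa [h.restrict_eq] at this

theorem IsTame.ae_mem (h : H.IsTame) : ∀ᵐ x ∂H.μ, x ∈ H.P := by
  have := ae_restrict_mem (μ := H.μ) h.compact.measurableSet
  rwa [h.restrict_eq] at this

theorem IsTame.integrable_toReal (h : H.IsTame) {u : V → ℝ≥0∞} (hu : H.IsState u) :
    Integrable (fun x => (u x).toReal) H.μ :=
  integrable_toReal_of_lintegral_ne_top (h.aemeasurable' hu)
    (by rw [h.lintegral_eq hu]; exact h.measure_ne_top)

theorem IsTame.integral_toReal (h : H.IsTame) {u : V → ℝ≥0∞} (hu : H.IsState u) :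
    ∫ x, (u x).toReal ∂H.μ = (H.μ H.P).toReal := by
  rw [MeasureTheory.integral_toReal (h.aemeasurable' hu), h.lintegral_eq hu]
  have := h.ae_lt_top hu
  rwa [h.restrict_eq] at this

theorem IsTame.klInt_ne_top_iff (h : H.IsTame) {u : V → ℝ≥0∞} (hu : H.IsState u) :
    H.klInt u ≠ ∞ ↔ Integrable (fun x => (u x).toReal * Real.log (u x).toReal) H.μ := by
  have := h.isFiniteMeasure
  have hkm : AEMeasurable (fun x => InformationTheory.klFun (u x).toReal) H.μ :=
    InformationTheory.measurable_klFun.comp_aemeasurable (h.aemeasurable' hu).ennreal_toReal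
  have h1 : H.klInt u ≠ ∞ ↔ Integrable (fun x => InformationTheory.klFun (u x).toReal) H.μ := by
    unfold klInt
    rw [h.restrict_eq]
    exact lintegral_ofReal_ne_top_iff_integrable hkm.aestronglyMeasurable
      (Eventually.of_forall fun x => InformationTheory.klFun_nonneg ENNReal.toReal_nonneg)
  rw [h1]
  have hi := (integrable_const (μ := H.μ) (1 : ℝ)).sub (h.integrable_toReal hu)
  constructor
  · intro hk
    refine (hk.sub hi).congr (Eventually.of_forall fun x => ?_)
    simp only [Pi.sub_apply, InformationTheory.klFun_apply]; ring
  · intro hk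
    refine (hk.add hi).congr (Eventually.of_forall fun x => ?_)
    simp only [Pi.sub_apply, Pi.add_apply, InformationTheory.klFun_apply]; ring

theorem IsTame.klInt_toReal (h : H.IsTame) {u : V → ℝ≥0∞} (hu : H.IsState u)
    (hk : H.klInt u ≠ ∞) :
    (H.klInt u).toReal = ∫ x, (u x).toReal * Real.log (u x).toReal ∂H.μ := by
  have := h.isFiniteMeasure
  have hkm : AEMeasurable (fun x => InformationTheory.klFun (u x).toReal) H.μ :=
    InformationTheory.measurable_klFun.comp_aemeasurable (h.aemeasurable' hu).ennreal_toReal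
  have hi : Integrable (fun x => (1 : ℝ) - (u x).toReal) H.μ :=
    (integrable_const _).sub (h.integrable_toReal hu)
  have h2 : ∫ x, InformationTheory.klFun (u x).toReal ∂H.μ = (H.klInt u).toReal := by
    rw [integral_eq_lintegral_of_nonneg_ae (Eventually.of_forall fun x =>
      InformationTheory.klFun_nonneg ENNReal.toReal_nonneg) hkm.aestronglyMeasurable]
    unfold klInt
    rw [h.restrict_eq]
  have h3 : ∫ x, ((1 : ℝ) - (u x).toReal) ∂H.μ = 0 := by
    rw [integral_sub (integrable_const _) (h.integrable_toReal hu), h.integral_toReal hu]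
    have : H.μ univ = H.μ H.P := by
      rw [← Measure.restrict_apply_univ (s := H.P), h.restrict_eq]
    simp [Measure.real, this]
  rw [← h2, ← add_zero (∫ x, (u x).toReal * Real.log (u x).toReal ∂H.μ), ← h3,
    ← integral_add ((h.klInt_ne_top_iff hu).1 hk) hi]
  congr 1
  ext x
  rw [InformationTheory.klFun_apply]; ring

theorem IsTame.entropy_eq_integral (h : H.IsTame) {u : V → ℝ≥0∞} (hu : H.IsState u)
    (hk : H.klInt u ≠ ∞) :
    H.entropy u = ((-((∫ x, (u x).toReal * Real.log (u x).toReal ∂H.μ) /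
      (H.μ H.P).toReal) : ℝ) : EReal) := by
  rw [h.entropy_eq_coe hu hk, h.klInt_toReal hu hk]

end MulLog

/-! ### Composite systems and product states. -/

section Composite

theorem composite_measure {V₁ V₂ : Type*} [MeasurableSpace V₁] [NormedAddCommGroup V₂]
    [NormedSpace ℝ V₂] [MeasurableSpace V₂] {H₁ : HamiltonianTriple V₁} {H₂ : HamiltonianTriple V₂}
    (h₂ : H₂.IsTame) :
    (H₁.composite H₂).μ (H₁.composite H₂).P = H₁.μ H₁.P * H₂.μ H₂.P := by
  have := h₂.isFiniteMeasure
  exact Measure.prod_prod _ _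

variable {V₁ V₂ : Type*} [NormedAddCommGroup V₁] [NormedSpace ℝ V₁] [MeasurableSpace V₁]
  [NormedAddCommGroup V₂] [NormedSpace ℝ V₂] [MeasurableSpace V₂] [BorelSpace V₁] [BorelSpace V₂]
  [SecondCountableTopology V₁] [SecondCountableTopology V₂]
  {H₁ : HamiltonianTriple V₁} {H₂ : HamiltonianTriple V₂}

theorem IsTame.composite [FiniteDimensional ℝ V₁] [FiniteDimensional ℝ V₂]
    (h₁ : H₁.IsTame) (h₂ : H₂.IsTame) : (H₁.composite H₂).IsTame where
  compact := h₁.compact.prod h₂.compact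
  convex := h₁.convex.prod h₂.convex
  interior_nonempty := by
    change (interior (H₁.P ×ˢ H₂.P)).Nonempty
    rw [interior_prod_eq]
    exact h₁.interior_nonempty.prod h₂.interior_nonempty
  flat := by
    obtain ⟨m₁, hm₁, e₁⟩ := h₁.flat
    obtain ⟨m₂, hm₂, e₂⟩ := h₂.flat
    refine ⟨m₁.prod m₂, inferInstance, ?_⟩
    change H₁.μ.prod H₂.μ = _
    rw [e₁, e₂, Measure.prod_restrict]
    rfl
  finite_boundary := by
    have := h₁.isFiniteMeasure
    have := h₂.isFiniteMeasure
    have := h₁.finite_boundary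
    have := h₂.finite_boundary
    change IsFiniteMeasure (H₁.σ.prod H₂.μ + H₁.μ.prod H₂.σ)
    infer_instance
  carried := by
    have := h₁.isFiniteMeasure
    have := h₂.isFiniteMeasure
    have := h₁.finite_boundary
    have := h₂.finite_boundary
    change (H₁.σ.prod H₂.μ + H₁.μ.prod H₂.σ) (frontier (H₁.P ×ˢ H₂.P))ᶜ = 0
    rw [Measure.add_apply, frontier_prod_eq, h₁.compact.isClosed.closure_eq,
      h₂.compact.isClosed.closure_eq, add_eq_zero]
    constructor
    · rw [← h₁.restrict_frontier_eq, ← h₂.restrict_eq, Measure.prod_restrict]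
      refine measure_mono_null (t := (frontier H₁.P ×ˢ H₂.P)ᶜ)
        (compl_subset_compl.2 subset_union_right) ?_
      rw [Measure.restrict_apply (measurableSet_frontier.prod
        h₂.compact.measurableSet).compl, compl_inter_self, measure_empty]
    · rw [← h₂.restrict_frontier_eq, ← h₁.restrict_eq, Measure.prod_restrict]
      refine measure_mono_null (t := (H₁.P ×ˢ frontier H₂.P)ᶜ)
        (compl_subset_compl.2 subset_union_left) ?_
      rw [Measure.restrict_apply (h₁.compact.measurableSet.prod
        measurableSet_frontier).compl, compl_inter_self, measure_empty]

theorem lintegral_composite_frontier [FiniteDimensional ℝ V₁] [FiniteDimensional ℝ V₂]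
    (h₁ : H₁.IsTame) (h₂ : H₂.IsTame) (u : V₁ × V₂ → ℝ≥0∞) :
    ∫⁻ z in frontier (H₁.composite H₂).P, u z ∂(H₁.composite H₂).σ =
      ∫⁻ z, u z ∂(H₁.σ.prod H₂.μ) + ∫⁻ z, u z ∂(H₁.μ.prod H₂.σ) := by
  rw [(h₁.composite h₂).restrict_frontier_eq]
  exact lintegral_add_measure _ _ _

theorem isState_prodState [FiniteDimensional ℝ V₁] [FiniteDimensional ℝ V₂]
    (h₁ : H₁.IsTame) (h₂ : H₂.IsTame) {u₁ : V₁ → ℝ≥0∞} {u₂ : V₂ → ℝ≥0∞}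
    (hu₁ : H₁.IsState u₁) (hu₂ : H₂.IsState u₂) :
    (H₁.composite H₂).IsState (prodState u₁ u₂) where
  pos z hz := ENNReal.mul_pos (hu₁.pos _ hz.1).ne' (hu₂.pos _ hz.2).ne'
  lsc := by
    refine LowerSemicontinuousOn.ennreal_mul ?_ ?_
    · intro z hz a ha
      have ht : Tendsto (Prod.fst : V₁ × V₂ → V₁) (𝓝[H₁.P ×ˢ H₂.P] z) (𝓝[H₁.P] z.1) :=
        continuous_fst.continuousWithinAt.tendsto_nhdsWithin fun w hw => hw.1
      exact ht.eventually (hu₁.lsc z.1 hz.1 a ha)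
    · intro z hz a ha
      have ht : Tendsto (Prod.snd : V₁ × V₂ → V₂) (𝓝[H₁.P ×ˢ H₂.P] z) (𝓝[H₂.P] z.2) :=
        continuous_snd.continuousWithinAt.tendsto_nhdsWithin fun w hw => hw.2
      exact ht.eventually (hu₂.lsc z.2 hz.2 a ha)
  logConvex x hx y hy t ht0 ht1 := by
    unfold prodState
    rw [ENNReal.mul_rpow_of_nonneg _ _ (by linarith : 0 ≤ 1 - t), ENNReal.mul_rpow_of_nonneg _ _ ht0,
      mul_mul_mul_comm]
    exact mul_le_mul' (hu₁.logConvex x.1 hx.1 y.1 hy.1 t ht0 ht1)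
      (hu₂.logConvex x.2 hx.2 y.2 hy.2 t ht0 ht1)
  normalized := by
    have := h₁.isFiniteMeasure
    have := h₂.isFiniteMeasure
    rw [(h₁.composite h₂).restrict_eq, composite_measure h₂, ← h₁.lintegral_eq hu₁,
      ← h₂.lintegral_eq hu₂]
    exact lintegral_prod_mul (h₁.aemeasurable' hu₁) (h₂.aemeasurable' hu₂)

theorem lintegral_frontier_prodState [FiniteDimensional ℝ V₁] [FiniteDimensional ℝ V₂]
    (h₁ : H₁.IsTame) (h₂ : H₂.IsTame) {u₁ : V₁ → ℝ≥0∞} {u₂ : V₂ → ℝ≥0∞}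
    (hu₁ : H₁.IsState u₁) (hu₂ : H₂.IsState u₂) :
    ∫⁻ z in frontier (H₁.composite H₂).P, prodState u₁ u₂ z ∂(H₁.composite H₂).σ =
      (∫⁻ x in frontier H₁.P, u₁ x ∂H₁.σ) * H₂.μ H₂.P +
        H₁.μ H₁.P * ∫⁻ x in frontier H₂.P, u₂ x ∂H₂.σ := by
  have := h₁.isFiniteMeasure
  have := h₂.isFiniteMeasure
  have := h₁.finite_boundary
  have := h₂.finite_boundary
  have hm₁ := h₁.aemeasurable_frontier hu₁
  have hm₂ := h₂.aemeasurable_frontier hu₂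
  rw [h₁.restrict_frontier_eq] at hm₁ ⊢
  rw [h₂.restrict_frontier_eq] at hm₂ ⊢
  rw [lintegral_composite_frontier h₁ h₂, ← h₁.lintegral_eq hu₁, ← h₂.lintegral_eq hu₂]
  unfold prodState
  rw [lintegral_prod_mul hm₁ (h₂.aemeasurable' hu₂), lintegral_prod_mul (h₁.aemeasurable' hu₁) hm₂]

theorem energy_prodState [FiniteDimensional ℝ V₁] [FiniteDimensional ℝ V₂]
    (h₁ : H₁.IsTame) (h₂ : H₂.IsTame) {u₁ : V₁ → ℝ≥0∞} {u₂ : V₂ → ℝ≥0∞}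
    (hu₁ : H₁.IsState u₁) (hu₂ : H₂.IsState u₂) {U₁ U₂ : ℝ} (hU₁ : H₁.energy u₁ = U₁)
    (hU₂ : H₂.energy u₂ = U₂) :
    (H₁.composite H₂).energy (prodState u₁ u₂) = ((U₁ + U₂ : ℝ) : EReal) := by
  have hE₁ := (energy_ne_top_iff h₁ (u := u₁)).1 (by rw [hU₁]; exact EReal.coe_ne_top _)
  have hE₂ := (energy_ne_top_iff h₂ (u := u₂)).1 (by rw [hU₂]; exact EReal.coe_ne_top _)
  rw [h₁.energy_eq_coe hE₁] at hU₁
  rw [h₂.energy_eq_coe hE₂] at hU₂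
  have e := lintegral_frontier_prodState h₁ h₂ hu₁ hu₂
  have t₁ := ENNReal.mul_ne_top hE₁ h₂.measure_ne_top
  have t₂ := ENNReal.mul_ne_top h₁.measure_ne_top hE₂
  rw [(h₁.composite h₂).energy_eq_coe (by rw [e]; exact ENNReal.add_ne_top.2 ⟨t₁, t₂⟩), e,
    composite_measure h₂, ENNReal.toReal_add t₁ t₂, ENNReal.toReal_mul, ENNReal.toReal_mul,
    ENNReal.toReal_mul, ← EReal.coe_injective hU₁, ← EReal.coe_injective hU₂]
  have n₁ := h₁.measure_toReal_pos
  have n₂ := h₂.measure_toReal_pos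
  congr 1
  field_simp

theorem mul_mul_log_mul (a b : ℝ) :
    a * b * Real.log (a * b) = a * Real.log a * b + a * (b * Real.log b) := by
  by_cases ha : a = 0
  · simp [ha]
  by_cases hb : b = 0
  · simp [hb]
  rw [Real.log_mul ha hb]; ring

/-- The logarithm of the product splits, and in each summand the factor without logarithm integrates
to the total mass of its system. -/
theorem entropy_prodState [FiniteDimensional ℝ V₁] [FiniteDimensional ℝ V₂]
    (h₁ : H₁.IsTame) (h₂ : H₂.IsTame) {u₁ : V₁ → ℝ≥0∞} {u₂ : V₂ → ℝ≥0∞}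
    (hu₁ : H₁.IsState u₁) (hu₂ : H₂.IsState u₂) (hk₁ : H₁.klInt u₁ ≠ ∞) (hk₂ : H₂.klInt u₂ ≠ ∞) :
    (H₁.composite H₂).entropy (prodState u₁ u₂) = H₁.entropy u₁ + H₂.entropy u₂ := by
  have := h₁.isFiniteMeasure
  have := h₂.isFiniteMeasure
  have h := h₁.composite h₂
  have hu := isState_prodState h₁ h₂ hu₁ hu₂
  have i₁ := (h₁.klInt_ne_top_iff hu₁).1 hk₁
  have i₂ := (h₂.klInt_ne_top_iff hu₂).1 hk₂
  have j₁ := h₁.integrable_toReal hu₁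
  have j₂ := h₂.integrable_toReal hu₂
  have hfun : (fun z => (prodState u₁ u₂ z).toReal * Real.log (prodState u₁ u₂ z).toReal) =
      fun z : V₁ × V₂ => (u₁ z.1).toReal * Real.log (u₁ z.1).toReal * (u₂ z.2).toReal +
        (u₁ z.1).toReal * ((u₂ z.2).toReal * Real.log (u₂ z.2).toReal) := by
    ext z
    unfold prodState
    rw [ENNReal.toReal_mul, mul_mul_log_mul]
  have k₁ := i₁.mul_prod j₂
  have k₂ := j₁.mul_prod i₂
  have hμ : (H₁.composite H₂).μ = H₁.μ.prod H₂.μ := rfl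
  have hk : (H₁.composite H₂).klInt (prodState u₁ u₂) ≠ ∞ := by
    rw [h.klInt_ne_top_iff hu, hfun, hμ]
    exact k₁.add k₂
  rw [h.entropy_eq_integral hu hk, h₁.entropy_eq_integral hu₁ hk₁, h₂.entropy_eq_integral hu₂ hk₂,
    hfun, composite_measure h₂, hμ, integral_add k₁ k₂,
    integral_prod_mul (fun x => (u₁ x).toReal * Real.log (u₁ x).toReal) fun y => (u₂ y).toReal,
    integral_prod_mul (fun x => (u₁ x).toReal) fun y => (u₂ y).toReal * Real.log (u₂ y).toReal,
    h₁.integral_toReal hu₁, h₂.integral_toReal hu₂, ENNReal.toReal_mul, ← EReal.coe_add]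
  have n₁ := h₁.measure_toReal_pos
  have n₂ := h₂.measure_toReal_pos
  congr 1
  field_simp
  ring

/-- Products of nearly optimal states are competitors. Taking strict lower bounds excludes states of
entropy `⊥`, to which additivity would not apply. -/
theorem eqEntropy_add_le [FiniteDimensional ℝ V₁] [FiniteDimensional ℝ V₂]
    (h₁ : H₁.IsTame) (h₂ : H₂.IsTame) (U₁ U₂ : ℝ) :
    H₁.eqEntropy U₁ + H₂.eqEntropy U₂ ≤ (H₁.composite H₂).eqEntropy (U₁ + U₂) := by
  refine EReal.add_le_of_forall_lt fun a ha b hb => ?_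
  obtain ⟨_, ⟨u₁, hu₁, rfl⟩, hlt₁⟩ := lt_sSup_iff.1 ha
  obtain ⟨_, ⟨u₂, hu₂, rfl⟩, hlt₂⟩ := lt_sSup_iff.1 hb
  have hk₁ : H₁.klInt u₁ ≠ ∞ := fun hk => by
    rw [h₁.entropy_eq_bot hu₁.1 hk] at hlt₁; exact not_lt_bot hlt₁
  have hk₂ : H₂.klInt u₂ ≠ ∞ := fun hk => by
    rw [h₂.entropy_eq_bot hu₂.1 hk] at hlt₂; exact not_lt_bot hlt₂
  refine (add_le_add hlt₁.le hlt₂.le).trans ?_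
  rw [← entropy_prodState h₁ h₂ hu₁.1 hu₂.1 hk₁ hk₂]
  exact entropy_le_eqEntropy (isState_prodState h₁ h₂ hu₁.1 hu₂.1)
    (energy_prodState h₁ h₂ hu₁.1 hu₂.1 hu₁.2 hu₂.2)

end Composite

end HamiltonianTriple

/-! ### Marginals and subadditivity of entropy. -/

namespace HamiltonianTriple

section Marginal

variable {V₁ V₂ : Type*} [NormedAddCommGroup V₁] [NormedSpace ℝ V₁] [MeasurableSpace V₁]
  [NormedAddCommGroup V₂] [NormedSpace ℝ V₂] [MeasurableSpace V₂] [BorelSpace V₁] [BorelSpace V₂]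
  [SecondCountableTopology V₁] [SecondCountableTopology V₂]
  [FiniteDimensional ℝ V₁] [FiniteDimensional ℝ V₂]
  {H₁ : HamiltonianTriple V₁} {H₂ : HamiltonianTriple V₂}

/-- The average of a function on `V₁ × V₂` over the second factor. -/
noncomputable def marginal {V₁ V₂ : Type*} [MeasurableSpace V₂] (H₂ : HamiltonianTriple V₂)
    (u : V₁ × V₂ → ℝ≥0∞) (x : V₁) : ℝ≥0∞ :=
  (H₂.μ H₂.P)⁻¹ * ∫⁻ y, u (x, y) ∂H₂.μ

theorem mul_marginal {V₁ V₂ : Type*} [NormedAddCommGroup V₂] [NormedSpace ℝ V₂]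
    [MeasurableSpace V₂] [BorelSpace V₂] {H₂ : HamiltonianTriple V₂} (h₂ : H₂.IsTame)
    (u : V₁ × V₂ → ℝ≥0∞) (x : V₁) :
    H₂.μ H₂.P * marginal H₂ u x = ∫⁻ y, u (x, y) ∂H₂.μ := by
  unfold marginal
  rw [← mul_assoc, ENNReal.mul_inv_cancel h₂.measure_pos.ne' h₂.measure_ne_top, one_mul]

/-- Log convexity in `x` for fixed `y` survives integration over `y` by Hölder, and lower
semicontinuity by Fatou. Global lower semicontinuity of `u` makes every section measurable. -/
theorem isState_marginal (h₁ : H₁.IsTame) (h₂ : H₂.IsTame) {u : V₁ × V₂ → ℝ≥0∞}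
    (hl : LowerSemicontinuous u) (hu : (H₁.composite H₂).IsState u) :
    H₁.IsState (marginal H₂ u) where
  pos x hx := by
    refine ENNReal.mul_pos (ENNReal.inv_ne_zero.2 h₂.measure_ne_top) fun h0 => ?_
    have hm : Measurable fun y => u (x, y) := (hl.comp (Continuous.prodMk_right x)).measurable
    rw [lintegral_eq_zero_iff hm] at h0
    have hne : (ae H₂.μ).NeBot := by
      rw [ae_neBot]
      intro hz
      have := h₂.measure_pos
      simp [hz] at this
    obtain ⟨y, hy0, hy⟩ := (h0.and h₂.ae_mem).exists
    exact (hu.pos (x, y) ⟨hx, hy⟩).ne' hy0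
  lsc := by
    have h := hl.lintegral_prodMk H₂.μ
    exact ((ENNReal.continuous_const_mul
      (ENNReal.inv_ne_top.2 h₂.measure_pos.ne')).comp_lowerSemicontinuous h
        fun a b hab => mul_le_mul_right hab _).lowerSemicontinuousOn _
  logConvex x hx x' hx' t ht0 ht1 := by
    have hm : ∀ z : V₁, AEMeasurable (fun y => u (z, y)) H₂.μ := fun z =>
      (hl.comp (Continuous.prodMk_right z)).measurable.aemeasurable
    have hH := ENNReal.lintegral_mul_norm_pow_le (hm x) (hm x') (by linarith : 0 ≤ 1 - t) ht0
      (by ring)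
    have hle : ∫⁻ y, u ((1 - t) • x + t • x', y) ∂H₂.μ ≤
        ∫⁻ y, u (x, y) ^ (1 - t) * u (x', y) ^ t ∂H₂.μ := by
      refine lintegral_mono_ae ?_
      filter_upwards [h₂.ae_mem] with y hy
      have := hu.logConvex (x, y) ⟨hx, hy⟩ (x', y) ⟨hx', hy⟩ t ht0 ht1
      have e : (1 - t) • (x, y) + t • (x', y) = ((1 - t) • x + t • x', y) := by
        rw [Prod.smul_mk, Prod.smul_mk, Prod.mk_add_mk, ← add_smul]; simp
      rwa [e] at this
    unfold marginal
    have hc0 : (H₂.μ H₂.P)⁻¹ ≠ 0 := ENNReal.inv_ne_zero.2 h₂.measure_ne_top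
    have hct : (H₂.μ H₂.P)⁻¹ ≠ ∞ := ENNReal.inv_ne_top.2 h₂.measure_pos.ne'
    rw [ENNReal.mul_rpow_of_nonneg _ _ (by linarith : 0 ≤ 1 - t), ENNReal.mul_rpow_of_nonneg _ _ ht0,
      mul_mul_mul_comm, ← ENNReal.rpow_add _ _ hc0 hct, sub_add_cancel, ENNReal.rpow_one]
    exact mul_le_mul_right (hle.trans hH) _
  normalized := by
    have := h₂.isFiniteMeasure
    have h := (h₁.composite h₂).lintegral_eq hu
    have e : ∫⁻ z, u z ∂(H₁.composite H₂).μ = ∫⁻ x, ∫⁻ y, u (x, y) ∂H₂.μ ∂H₁.μ :=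
      lintegral_prod _ hl.measurable.aemeasurable
    rw [e, composite_measure h₂] at h
    unfold marginal
    rw [h₁.restrict_eq, lintegral_const_mul' _ _ (ENNReal.inv_ne_top.2 h₂.measure_pos.ne'), h,
      mul_comm, mul_assoc, ENNReal.mul_inv_cancel h₂.measure_pos.ne' h₂.measure_ne_top, mul_one]

/-- By this symmetry, the second marginal is the first marginal of the swapped state. -/
theorem isState_swap (h₁ : H₁.IsTame) (h₂ : H₂.IsTame) {u : V₁ × V₂ → ℝ≥0∞}
    (hl : LowerSemicontinuous u) (hu : (H₁.composite H₂).IsState u) :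
    (H₂.composite H₁).IsState (u ∘ Prod.swap) where
  pos z hz := hu.pos _ ⟨hz.2, hz.1⟩
  lsc := (hl.comp continuous_swap).lowerSemicontinuousOn _
  logConvex x hx y hy t ht0 ht1 := hu.logConvex x.swap ⟨hx.2, hx.1⟩ y.swap ⟨hy.2, hy.1⟩ t ht0 ht1
  normalized := by
    have := h₁.isFiniteMeasure
    have := h₂.isFiniteMeasure
    rw [(h₂.composite h₁).restrict_eq, composite_measure h₁, mul_comm, ← composite_measure h₂,
      ← (h₁.composite h₂).lintegral_eq hu]
    exact lintegral_prod_swap (μ := H₁.μ) (ν := H₂.μ) u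

omit [NormedSpace ℝ V₁] [FiniteDimensional ℝ V₁] [FiniteDimensional ℝ V₂]
  [SecondCountableTopology V₁] in
theorem lintegral_prod_marginal (h₂ : H₂.IsTame) {u : V₁ × V₂ → ℝ≥0∞}
    (hl : LowerSemicontinuous u) (σ : Measure V₁) :
    ∫⁻ z, u z ∂(σ.prod H₂.μ) = H₂.μ H₂.P * ∫⁻ x, marginal H₂ u x ∂σ := by
  have := h₂.isFiniteMeasure
  rw [lintegral_prod _ hl.measurable.aemeasurable, ← lintegral_const_mul' _ _ h₂.measure_ne_top]
  simp only [mul_marginal h₂]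

/-- The energy of a state of a composite is the sum of the energies of its marginals. -/
theorem exists_energy_marginal (h₁ : H₁.IsTame) (h₂ : H₂.IsTame) {u : V₁ × V₂ → ℝ≥0∞}
    (hl : LowerSemicontinuous u) {U : ℝ} (hU : (H₁.composite H₂).energy u = U) :
    ∃ E₁ E₂ : ℝ, E₁ + E₂ = U ∧ H₁.energy (marginal H₂ u) = E₁ ∧
      H₂.energy (marginal H₁ (u ∘ Prod.swap)) = E₂ := by
  have := h₁.isFiniteMeasure
  have := h₂.isFiniteMeasure
  have := h₁.finite_boundary
  have := h₂.finite_boundary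
  have h := h₁.composite h₂
  have hE := (energy_ne_top_iff h (u := u)).1 (by rw [hU]; exact EReal.coe_ne_top _)
  rw [h.energy_eq_coe hE, EReal.coe_eq_coe_iff] at hU
  have e₂ : ∫⁻ z, u z ∂(H₁.μ.prod H₂.σ) =
      H₁.μ H₁.P * ∫⁻ x, marginal H₁ (u ∘ Prod.swap) x ∂H₂.σ := by
    rw [← lintegral_prod_marginal h₁ (hl.comp continuous_swap), ← lintegral_prod_swap]
    rfl
  have e := lintegral_composite_frontier h₁ h₂ u
  rw [lintegral_prod_marginal h₂ hl, e₂] at e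
  rw [e] at hE hU
  obtain ⟨t₁, t₂⟩ := ENNReal.add_ne_top.1 hE
  have s₁ : ∫⁻ x, marginal H₂ u x ∂H₁.σ ≠ ∞ := fun h => t₁ (by
    rw [h, ENNReal.mul_top h₂.measure_pos.ne'])
  have s₂ : ∫⁻ x, marginal H₁ (u ∘ Prod.swap) x ∂H₂.σ ≠ ∞ := fun h => t₂ (by
    rw [h, ENNReal.mul_top h₁.measure_pos.ne'])
  refine ⟨_, _, ?_, h₁.energy_eq_coe (by rwa [h₁.restrict_frontier_eq]),
    h₂.energy_eq_coe (by rwa [h₂.restrict_frontier_eq])⟩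
  rw [← hU, h₁.restrict_frontier_eq, h₂.restrict_frontier_eq, ENNReal.toReal_add t₁ t₂,
    composite_measure h₂, ENNReal.toReal_mul, ENNReal.toReal_mul, ENNReal.toReal_mul]
  have n₁ := h₁.measure_toReal_pos
  have n₂ := h₂.measure_toReal_pos
  field_simp

/-- Integrating a function of the first variable against a state of a composite. -/
theorem integral_mul_fst (h₁ : H₁.IsTame) (h₂ : H₂.IsTame) {u : V₁ × V₂ → ℝ≥0∞}
    (hl : LowerSemicontinuous u) (hu : (H₁.composite H₂).IsState u) {g : V₁ → ℝ}
    (hg : Measurable g) (hi : Integrable (fun x => (marginal H₂ u x).toReal * g x) H₁.μ) :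
    Integrable (fun z => (u z).toReal * g z.1) (H₁.μ.prod H₂.μ) ∧
      ∫ z, (u z).toReal * g z.1 ∂(H₁.μ.prod H₂.μ) =
        (H₂.μ H₂.P).toReal * ∫ x, (marginal H₂ u x).toReal * g x ∂H₁.μ := by
  have := h₁.isFiniteMeasure
  have := h₂.isFiniteMeasure
  have hfin : ∀ᵐ x ∂H₁.μ, ∫⁻ y, u (x, y) ∂H₂.μ ≠ ∞ := by
    have := h₁.ae_lt_top (isState_marginal h₁ h₂ hl hu)
    rw [h₁.restrict_eq] at this
    filter_upwards [this] with x hx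
    rw [← mul_marginal h₂]
    exact ENNReal.mul_ne_top h₂.measure_ne_top hx.ne
  have hmx : ∀ x, Measurable fun y => u (x, y) := fun x =>
    (hl.comp (Continuous.prodMk_right x)).measurable
  have hint : ∀ᵐ x ∂H₁.μ, Integrable (fun y => (u (x, y)).toReal) H₂.μ := by
    filter_upwards [hfin] with x hx
    exact integrable_toReal_of_lintegral_ne_top (hmx x).aemeasurable hx
  have hval : ∀ᵐ x ∂H₁.μ, ∫ y, (u (x, y)).toReal ∂H₂.μ =
      (H₂.μ H₂.P).toReal * (marginal H₂ u x).toReal := by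
    filter_upwards [hfin] with x hx
    rw [MeasureTheory.integral_toReal (hmx x).aemeasurable (ae_lt_top (hmx x) hx),
      ← mul_marginal h₂, ENNReal.toReal_mul]
  have hI : Integrable (fun z => (u z).toReal * g z.1) (H₁.μ.prod H₂.μ) := by
    have hm : Measurable fun z : V₁ × V₂ => (u z).toReal * g z.1 :=
      hl.measurable.ennreal_toReal.mul (hg.comp measurable_fst)
    rw [integrable_prod_iff hm.aestronglyMeasurable]
    constructor
    · filter_upwards [hint] with x hx using hx.mul_const _
    · refine (hi.norm.const_mul (H₂.μ H₂.P).toReal).congr ?_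
      filter_upwards [hval] with x hx
      simp only [norm_mul, Real.norm_eq_abs, ENNReal.abs_toReal]
      rw [integral_mul_const, hx]; ring
  refine ⟨hI, ?_⟩
  rw [integral_prod _ hI, ← integral_const_mul]
  refine integral_congr_ae ?_
  filter_upwards [hval] with x hx
  rw [integral_mul_const, hx]; ring

/-- The pointwise Gibbs inequality, from `log x ≤ x - 1` at `x = b / a`. -/
theorem mul_log_ge {a b : ℝ} (ha : 0 ≤ a) (hb : 0 < b) :
    a * Real.log b + a - b ≤ a * Real.log a := by
  rcases ha.eq_or_lt with rfl | ha
  · simp [hb.le]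
  have h := Real.log_le_sub_one_of_pos (div_pos hb ha)
  rw [Real.log_div hb.ne' ha.ne'] at h
  have h2 := mul_le_mul_of_nonneg_left h ha.le
  have h3 : a * (b / a - 1) = b - a := by field_simp
  rw [h3] at h2
  linarith

/-- Subadditivity of the entropy. -/
theorem entropy_le_marginal (h₁ : H₁.IsTame) (h₂ : H₂.IsTame) {u : V₁ × V₂ → ℝ≥0∞}
    (hl : LowerSemicontinuous u) (hu : (H₁.composite H₂).IsState u)
    (hk₁ : H₁.klInt (marginal H₂ u) ≠ ∞) (hk₂ : H₂.klInt (marginal H₁ (u ∘ Prod.swap)) ≠ ∞) :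
    (H₁.composite H₂).entropy u ≤
      H₁.entropy (marginal H₂ u) + H₂.entropy (marginal H₁ (u ∘ Prod.swap)) := by
  have := h₁.isFiniteMeasure
  have := h₂.isFiniteMeasure
  have h := h₁.composite h₂
  have hls := hl.comp (continuous_swap (X := V₂) (Y := V₁))
  have hus := isState_swap h₁ h₂ hl hu
  have hs₁ := isState_marginal h₁ h₂ hl hu
  have hs₂ := isState_marginal h₂ h₁ hls hus
  set v₁ := marginal H₂ u with hv₁
  set v₂ := marginal H₁ (u ∘ Prod.swap) with hv₂
  have hm₁ : Measurable v₁ :=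
    (hl.lintegral_prodMk H₂.μ).measurable.const_mul _
  have hm₂ : Measurable v₂ := (hls.lintegral_prodMk H₁.μ).measurable.const_mul _
  by_cases hk : (H₁.composite H₂).klInt u = ∞
  · rw [h.entropy_eq_bot hu hk]; exact bot_le
  have hμ : (H₁.composite H₂).μ = H₁.μ.prod H₂.μ := rfl
  obtain ⟨i₁, e₁⟩ := integral_mul_fst h₁ h₂ hl hu (g := fun x => Real.log (v₁ x).toReal)
    (Real.measurable_log.comp hm₁.ennreal_toReal) ((h₁.klInt_ne_top_iff hs₁).1 hk₁)
  obtain ⟨i₂, e₂⟩ := integral_mul_fst h₂ h₁ hls hus (g := fun x => Real.log (v₂ x).toReal)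
    (Real.measurable_log.comp hm₂.ennreal_toReal) ((h₂.klInt_ne_top_iff hs₂).1 hk₂)
  have i₂' : Integrable (fun z : V₁ × V₂ => (u z).toReal * Real.log (v₂ z.2).toReal)
      (H₁.μ.prod H₂.μ) := i₂.swap
  have e₂' : ∫ z : V₁ × V₂, (u z).toReal * Real.log (v₂ z.2).toReal ∂(H₁.μ.prod H₂.μ) =
      (H₁.μ H₁.P).toReal * ∫ y, (v₂ y).toReal * Real.log (v₂ y).toReal ∂H₂.μ := by
    rw [← e₂, ← integral_prod_swap]
    rfl
  have i₃ := h.integrable_toReal hu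
  have i₄ := (h₁.integrable_toReal hs₁).mul_prod (h₂.integrable_toReal hs₂)
  have i₅ := (h.klInt_ne_top_iff hu).1 hk
  have e₃ := h.integral_toReal hu
  have e₄ := integral_prod_mul (μ := H₁.μ) (ν := H₂.μ) (fun x => (v₁ x).toReal)
    fun y => (v₂ y).toReal
  rw [h₁.integral_toReal hs₁, h₂.integral_toReal hs₂] at e₄
  rw [composite_measure h₂, ENNReal.toReal_mul] at e₃
  rw [hμ] at i₃ i₅ e₃
  have hp : ∀ᵐ z ∂(H₁.μ.prod H₂.μ), 0 < (v₁ z.1).toReal ∧ 0 < (v₂ z.2).toReal := by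
    have p₁ : ∀ᵐ x ∂H₁.μ, 0 < (v₁ x).toReal := by
      have := h₁.ae_lt_top hs₁
      rw [h₁.restrict_eq] at this
      filter_upwards [this, h₁.ae_mem] with x hx hxP
      exact ENNReal.toReal_pos (hs₁.pos x hxP).ne' hx.ne
    have p₂ : ∀ᵐ x ∂H₂.μ, 0 < (v₂ x).toReal := by
      have := h₂.ae_lt_top hs₂
      rw [h₂.restrict_eq] at this
      filter_upwards [this, h₂.ae_mem] with x hx hxP
      exact ENNReal.toReal_pos (hs₂.pos x hxP).ne' hx.ne
    filter_upwards [Measure.quasiMeasurePreserving_fst.ae p₁,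
      Measure.quasiMeasurePreserving_snd.ae p₂] with z hz₁ hz₂ using ⟨hz₁, hz₂⟩
  -- Gibbs' inequality is applied with `a = u` and `b = v₁ v₂`. Both have the same total mass, so
  -- the terms `a - b` integrate to zero.
  have key := integral_mono_ae (((i₁.add i₂').add i₃).sub i₄) i₅ (by
    filter_upwards [hp] with z hz
    have := mul_log_ge (ENNReal.toReal_nonneg (a := u z)) (mul_pos hz.1 hz.2)
    rw [Real.log_mul hz.1.ne' hz.2.ne', mul_add] at this
    exact this)
  rw [integral_sub' ((i₁.add i₂').add i₃) i₄, integral_add' (i₁.add i₂') i₃,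
    integral_add' i₁ i₂', e₁, e₂', e₃, e₄] at key
  rw [h.entropy_eq_integral hu hk, h₁.entropy_eq_integral hs₁ hk₁, h₂.entropy_eq_integral hs₂ hk₂,
    ← EReal.coe_add, EReal.coe_le_coe_iff, composite_measure h₂, ENNReal.toReal_mul, hμ]
  have n₁ := h₁.measure_toReal_pos
  have n₂ := h₂.measure_toReal_pos
  rw [← neg_add, neg_le_neg_iff, div_add_div _ _ n₁.ne' n₂.ne']
  gcongr
  linarith

/-- The equilibrium entropy of a composite is the sup-convolution of the equilibrium entropies. -/
theorem exists_entropy_le_add (h₁ : H₁.IsTame) (h₂ : H₂.IsTame)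
    (hf₁ : ∀ u, H₁.IsState u → H₁.energy u ≠ ⊤ → H₁.klInt u ≠ ∞)
    (hf₂ : ∀ u, H₂.IsState u → H₂.energy u ≠ ⊤ → H₂.klInt u ≠ ∞)
    {u : V₁ × V₂ → ℝ≥0∞} (hu : (H₁.composite H₂).IsState u) {U : ℝ}
    (hU : (H₁.composite H₂).energy u = U) :
    ∃ E₁ E₂ : ℝ, E₁ + E₂ = U ∧
      (H₁.composite H₂).entropy u ≤ H₁.eqEntropy E₁ + H₂.eqEntropy E₂ := by
  classical
  have h := h₁.composite h₂
  -- The extension by `∞` changes neither energy nor entropy, and it is lower semicontinuous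
  -- everywhere, as the marginal lemmas require.
  set w := (H₁.composite H₂).P.piecewise u (fun _ => ∞) with hw
  have hl : LowerSemicontinuous w := hu.lsc.piecewise_top h.compact.isClosed
  have heq : ∀ z ∈ (H₁.composite H₂).P, w z = u z := fun z hz => piecewise_eq_of_mem _ _ _ hz
  have hws : (H₁.composite H₂).IsState w :=
    { pos := fun z hz => by rw [heq z hz]; exact hu.pos z hz
      lsc := hl.lowerSemicontinuousOn _
      logConvex := fun x hx y hy t ht0 ht1 => by
        rw [heq x hx, heq y hy, heq _ (h.convex hx hy (by linarith) ht0 (by ring))]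
        exact hu.logConvex x hx y hy t ht0 ht1
      normalized := by
        rw [← hu.normalized]
        exact setLIntegral_congr_fun h.compact.measurableSet heq }
  have hwU : (H₁.composite H₂).energy w = U := by
    rw [← hU]
    unfold energy
    rw [setLIntegral_congr_fun measurableSet_frontier fun z hz =>
      heq z (h.compact.isClosed.frontier_subset hz)]
  have hwS : (H₁.composite H₂).entropy w = (H₁.composite H₂).entropy u := by
    rw [h.entropy_eq hws, h.entropy_eq hu]
    have : (H₁.composite H₂).klInt w = (H₁.composite H₂).klInt u := by
      unfold klInt
      exact setLIntegral_congr_fun h.compact.measurableSet fun z hz => by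
        simp only [heq z hz]
    rw [this]
  obtain ⟨E₁, E₂, hE, he₁, he₂⟩ := exists_energy_marginal h₁ h₂ hl hwU
  have hls := hl.comp (continuous_swap (X := V₂) (Y := V₁))
  have hs₁ := isState_marginal h₁ h₂ hl hws
  have hs₂ := isState_marginal h₂ h₁ hls (isState_swap h₁ h₂ hl hws)
  refine ⟨E₁, E₂, hE, ?_⟩
  rw [← hwS]
  refine (entropy_le_marginal h₁ h₂ hl hws
    (hf₁ _ hs₁ (by rw [he₁]; exact EReal.coe_ne_top _))
    (hf₂ _ hs₂ (by rw [he₂]; exact EReal.coe_ne_top _))).trans ?_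
  exact add_le_add (entropy_le_eqEntropy hs₁ he₁) (entropy_le_eqEntropy hs₂ he₂)

end Marginal

end HamiltonianTriple

/-! ### One-sided derivatives of concave functions with values in `[-∞, ∞]`. -/

section Slope

/-- The difference quotient of `f` at `U`, where `f` takes the value `s`. -/
noncomputable def erealSlope (f : ℝ → EReal) (U s h : ℝ) : EReal :=
  (f (U + h) - (s : EReal)) / (h : EReal)

variable {f : ℝ → EReal} {U s : ℝ}

theorem le_erealSlope_of_pos {b h : ℝ} (hh : 0 < h) :
    (b : EReal) ≤ erealSlope f U s h ↔ ((s + b * h : ℝ) : EReal) ≤ f (U + h) := by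
  unfold erealSlope
  rw [EReal.le_div_iff_mul_le (by exact_mod_cast hh) (EReal.coe_ne_top _),
    EReal.le_sub_iff_add_le (Or.inl (EReal.coe_ne_bot _)) (Or.inl (EReal.coe_ne_top _)),
    ← EReal.coe_mul, ← EReal.coe_add, add_comm]

theorem erealSlope_le_of_pos {b h : ℝ} (hh : 0 < h) :
    erealSlope f U s h ≤ (b : EReal) ↔ f (U + h) ≤ ((s + b * h : ℝ) : EReal) := by
  unfold erealSlope
  rw [EReal.div_le_iff_le_mul (by exact_mod_cast hh) (EReal.coe_ne_top _),
    EReal.sub_le_iff_le_add (Or.inl (EReal.coe_ne_bot _)) (Or.inl (EReal.coe_ne_top _)),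
    ← EReal.coe_mul, ← EReal.coe_add, mul_comm h b, add_comm (b * h) s]

theorem erealSlope_eq_neg (h : ℝ) :
    erealSlope f U s h = -erealSlope (fun x => f (-x)) (-U) s (-h) := by
  unfold erealSlope
  have e : f (- (-U + -h)) = f (U + h) := by congr 1; ring
  change _ = -((f (-(-U + -h)) - (s : EReal)) / ((-h : ℝ) : EReal))
  rw [e, EReal.coe_neg, EReal.div_eq_inv_mul, EReal.div_eq_inv_mul, EReal.inv_neg, EReal.neg_mul,
    neg_neg]

theorem le_erealSlope_of_neg {b h : ℝ} (hh : h < 0) :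
    (b : EReal) ≤ erealSlope f U s h ↔ f (U + h) ≤ ((s + b * h : ℝ) : EReal) := by
  rw [erealSlope_eq_neg, EReal.le_neg, ← EReal.coe_neg, erealSlope_le_of_pos (neg_pos.2 hh)]
  ring_nf

theorem erealSlope_le_of_neg {b h : ℝ} (hh : h < 0) :
    erealSlope f U s h ≤ (b : EReal) ↔ ((s + b * h : ℝ) : EReal) ≤ f (U + h) := by
  rw [erealSlope_eq_neg, EReal.neg_le, ← EReal.coe_neg, le_erealSlope_of_pos (neg_pos.2 hh)]
  ring_nf

/-- Concavity of a function with values in `[-∞, ∞]` in terms of its hypograph. -/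
def HypographConvex (f : ℝ → EReal) : Prop :=
  ∀ ⦃U W s r t : ℝ⦄, 0 < t → t < 1 → (s : EReal) ≤ f U → (r : EReal) ≤ f W →
    (((1 - t) * s + t * r : ℝ) : EReal) ≤ f ((1 - t) * U + t * W)

/-- A supremum need not be attained, so concavity is first available only for values strictly below
it; lowering both values by the same `ε` recovers the rest. -/
theorem hypographConvex_of_lt
    (hf : ∀ ⦃U W s r t : ℝ⦄, 0 < t → t < 1 → (s : EReal) < f U → (r : EReal) < f W →
      (((1 - t) * s + t * r : ℝ) : EReal) ≤ f ((1 - t) * U + t * W)) : HypographConvex f := by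
  intro U W s r t ht0 ht1 hs hr
  rw [← EReal.ge_of_forall_gt_iff_ge]
  intro z hz
  rw [EReal.coe_lt_coe_iff] at hz
  set ε := (1 - t) * s + t * r - z with hε
  have hε0 : 0 < ε := by linarith
  have h := hf ht0 ht1 (lt_of_lt_of_le (EReal.coe_lt_coe_iff.2 (sub_lt_self s hε0)) hs)
    (lt_of_lt_of_le (EReal.coe_lt_coe_iff.2 (sub_lt_self r hε0)) hr)
  have e : (1 - t) * (s - ε) + t * (r - ε) = z := by rw [hε]; ring
  rwa [e] at h

theorem HypographConvex.comp_neg (hf : HypographConvex f) : HypographConvex fun x => f (-x) := by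
  intro U W s r t ht0 ht1 hs hr
  have := hf ht0 ht1 hs hr
  have e : (1 - t) * -U + t * -W = -((1 - t) * U + t * W) := by ring
  rwa [e] at this

theorem HypographConvex.erealSlope_le_of_pos (hf : HypographConvex f) (hs : f U = s) {h k : ℝ}
    (hh : 0 < h) (hhk : h ≤ k) : erealSlope f U s k ≤ erealSlope f U s h := by
  rcases hhk.eq_or_lt with rfl | hlt
  · exact le_rfl
  have hk : 0 < k := hh.trans hlt
  rw [← EReal.ge_of_forall_gt_iff_ge]
  intro b hb
  rw [le_erealSlope_of_pos hh]
  have h1 := (le_erealSlope_of_pos hk).1 hb.le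
  have h2 := hf (div_pos hh hk) ((div_lt_one hk).2 hlt) hs.ge h1
  have e1 : (1 - h / k) * s + h / k * (s + b * k) = s + b * h := by field_simp; ring
  have e2 : (1 - h / k) * U + h / k * (U + k) = U + h := by field_simp; ring
  rwa [e1, e2] at h2

theorem HypographConvex.erealSlope_le_of_neg (hf : HypographConvex f) (hs : f U = s) {h k : ℝ}
    (hk : k < 0) (hhk : h ≤ k) : erealSlope f U s k ≤ erealSlope f U s h := by
  rw [erealSlope_eq_neg k, erealSlope_eq_neg h, EReal.neg_le_neg_iff]
  exact hf.comp_neg.erealSlope_le_of_pos (by simpa using hs) (neg_pos.2 hk) (neg_le_neg hhk)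

/-- The chord from `U + h` to `U + k` passes below `(U, s)`. The value at `U + h` may be infinite
and is tested by real numbers below it. -/
theorem HypographConvex.erealSlope_le_of_neg_of_pos (hf : HypographConvex f) (hs : f U = s)
    {h k : ℝ} (hh : h < 0) (hk : 0 < k) : erealSlope f U s k ≤ erealSlope f U s h := by
  rw [← EReal.ge_of_forall_gt_iff_ge]
  intro b hb
  rw [le_erealSlope_of_neg hh, ← EReal.ge_of_forall_gt_iff_ge]
  intro r hr
  have h1 := (le_erealSlope_of_pos hk).1 hb.le
  have hd : 0 < k - h := by linarith
  have h2 := hf (div_pos (neg_pos.2 hh) hd) ((div_lt_one hd).2 (by linarith)) hr.le h1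
  have e2 : (1 - -h / (k - h)) * (U + h) + -h / (k - h) * (U + k) = U := by field_simp; ring
  rw [e2, hs, EReal.coe_le_coe_iff] at h2
  have e1 : (1 - -h / (k - h)) * r + -h / (k - h) * (s + b * k) =
      (k * r - h * (s + b * k)) / (k - h) := by field_simp; ring
  rw [e1, div_le_iff₀ hd] at h2
  rw [EReal.coe_le_coe_iff]
  have h3 : k * r ≤ k * (s + b * h) := by linarith
  exact le_of_mul_le_mul_left h3 hk

/-- The right derivative, as a supremum of difference quotients. -/
noncomputable def rightSlope (f : ℝ → EReal) (U s : ℝ) : EReal :=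
  sSup (erealSlope f U s '' Ioi 0)

/-- The left derivative, as an infimum of difference quotients. -/
noncomputable def leftSlope (f : ℝ → EReal) (U s : ℝ) : EReal :=
  sInf (erealSlope f U s '' Iio 0)

theorem erealSlope_le_rightSlope {h : ℝ} (hh : 0 < h) : erealSlope f U s h ≤ rightSlope f U s :=
  le_sSup ⟨h, hh, rfl⟩

theorem leftSlope_le_erealSlope {h : ℝ} (hh : h < 0) : leftSlope f U s ≤ erealSlope f U s h :=
  sInf_le ⟨h, hh, rfl⟩

theorem rightSlope_le_iff {b : EReal} :
    rightSlope f U s ≤ b ↔ ∀ h : ℝ, 0 < h → erealSlope f U s h ≤ b := by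
  simp [rightSlope, sSup_le_iff]

theorem le_leftSlope_iff {b : EReal} :
    b ≤ leftSlope f U s ↔ ∀ h : ℝ, h < 0 → b ≤ erealSlope f U s h := by
  simp [leftSlope, le_sInf_iff]

theorem HypographConvex.rightSlope_le_leftSlope (hf : HypographConvex f) (hs : f U = s) :
    rightSlope f U s ≤ leftSlope f U s :=
  rightSlope_le_iff.2 fun _ hk => le_leftSlope_iff.2 fun _ hh =>
    hf.erealSlope_le_of_neg_of_pos hs hh hk

theorem HypographConvex.tendsto_rightSlope (hf : HypographConvex f) (hs : f U = s) :
    Tendsto (erealSlope f U s) (𝓝[>] 0) (𝓝 (rightSlope f U s)) :=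
  AntitoneOn.tendsto_nhdsGT (fun _ hh _ _ hhk => hf.erealSlope_le_of_pos hs hh hhk)
    (OrderTop.bddAbove _)

theorem HypographConvex.tendsto_leftSlope (hf : HypographConvex f) (hs : f U = s) :
    Tendsto (erealSlope f U s) (𝓝[<] 0) (𝓝 (leftSlope f U s)) :=
  AntitoneOn.tendsto_nhdsLT (fun _ _ _ hk hhk => hf.erealSlope_le_of_neg hs hk hhk)
    (OrderBot.bddBelow _)

/-- A real number between the one sided derivatives is a supergradient. -/
theorem le_of_rightSlope_le_of_le_leftSlope (hs : f U = s) {b : ℝ} (hr : rightSlope f U s ≤ b)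
    (hl : b ≤ leftSlope f U s) (h : ℝ) : f (U + h) ≤ ((s + b * h : ℝ) : EReal) := by
  rcases lt_trichotomy h 0 with hh | rfl | hh
  · exact (le_erealSlope_of_neg hh).1 (hl.trans (leftSlope_le_erealSlope hh))
  · simp [hs]
  · exact (erealSlope_le_of_pos hh).1 ((erealSlope_le_rightSlope hh).trans hr)

/-- The chord from `(U, s)` to `(E, 0)` already has positive slope. -/
theorem rightSlope_pos {E : ℝ} (hUE : U < E) (hE : f E = 0) (hs : s < 0) :
    0 < rightSlope f U s := by
  have hh : 0 < E - U := sub_pos.2 hUE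
  have h1 : (((-s) / (E - U) : ℝ) : EReal) ≤ erealSlope f U s (E - U) := by
    rw [le_erealSlope_of_pos hh, div_mul_cancel₀ _ hh.ne', add_neg_cancel, add_sub_cancel, hE]
    rfl
  refine lt_of_lt_of_le ?_ (h1.trans (erealSlope_le_rightSlope hh))
  exact_mod_cast div_pos (neg_pos.2 hs) hh

end Slope

/-! ### Maximizers and slopes of sup-convolutions. -/

section SupConvolution

variable {f g k : ℝ → EReal} {U W s r : ℝ}

/-- The slope of `f` towards `U + h` is a real bound for the slope of `g` towards `W - h`, so what
`f` gains is at most what `g` loses. The bound `f ≤ 0` excludes the value `⊤`. -/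
theorem add_le_of_erealSlope_le (hf0 : ∀ x, f x ≤ 0) {h : ℝ} (hh : 0 < h)
    (hle : erealSlope f U s h ≤ erealSlope g W r (-h)) :
    f (U + h) + g (W - h) ≤ ((s + r : ℝ) : EReal) := by
  by_cases hbot : f (U + h) = ⊥
  · rw [hbot, EReal.bot_add]; exact bot_le
  obtain ⟨a, ha⟩ : ∃ a : ℝ, f (U + h) = a :=
    ⟨(f (U + h)).toReal, (EReal.coe_toReal
      (ne_top_of_le_ne_top EReal.zero_ne_top (hf0 _)) hbot).symm⟩
  have h1 : (((a - s) / h : ℝ) : EReal) ≤ erealSlope f U s h := by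
    rw [le_erealSlope_of_pos hh, div_mul_cancel₀ _ hh.ne', add_sub_cancel, ha]
  have h2 := (le_erealSlope_of_neg (neg_lt_zero.2 hh)).1 (h1.trans hle)
  rw [mul_neg, div_mul_cancel₀ _ hh.ne', ← sub_eq_add_neg W] at h2
  refine (add_le_add ha.le h2).trans ?_
  rw [← EReal.coe_add, EReal.coe_le_coe_iff]
  linarith

theorem erealSlope_le_of_add_le (hfg : ∀ h : ℝ, f (U + h) + g (W - h) ≤ ((s + r : ℝ) : EReal))
    {h : ℝ} (hh : 0 < h) : erealSlope f U s h ≤ erealSlope g W r (-h) := by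
  rw [← EReal.ge_of_forall_gt_iff_ge]
  intro b hb
  rw [le_erealSlope_of_neg (neg_lt_zero.2 hh), ← sub_eq_add_neg]
  have h1 := (le_erealSlope_of_pos hh).1 hb.le
  have h2 := (add_le_add_left h1 (g (W - h))).trans (hfg h)
  rw [add_comm] at h2
  have h3 := (EReal.le_sub_iff_add_le (Or.inl (EReal.coe_ne_bot _))
    (Or.inl (EReal.coe_ne_top _))).2 h2
  rw [← EReal.coe_sub] at h3
  refine h3.trans (EReal.coe_le_coe_iff.2 ?_)
  linarith

/-- The pair `(U, W)` maximizes `f + g` on a line of constant sum if and only if the intervals of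
supergradients meet. -/
theorem forall_add_le_iff (hf : HypographConvex f) (hg : HypographConvex g)
    (hf0 : ∀ x, f x ≤ 0) (hg0 : ∀ x, g x ≤ 0) (hs : f U = s) (hr : g W = r) :
    (∀ h : ℝ, f (U + h) + g (W - h) ≤ ((s + r : ℝ) : EReal)) ↔
      rightSlope f U s ≤ leftSlope g W r ∧ rightSlope g W r ≤ leftSlope f U s := by
  constructor
  · intro H
    have H' : ∀ h : ℝ, g (W + h) + f (U - h) ≤ ((r + s : ℝ) : EReal) := fun h => by
      have := H (-h)
      rwa [sub_neg_eq_add, ← sub_eq_add_neg, add_comm, add_comm s r] at this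
    have aux : ∀ {f g : ℝ → EReal} {U W s r : ℝ}, HypographConvex f → HypographConvex g →
        f U = s → g W = r → (∀ h : ℝ, f (U + h) + g (W - h) ≤ ((s + r : ℝ) : EReal)) →
        rightSlope f U s ≤ leftSlope g W r := by
      intro f g U W s r hf hg hs hr H
      refine rightSlope_le_iff.2 fun h hh => le_leftSlope_iff.2 fun k hk => ?_
      -- Slopes are antitone in the step, so both may be compared at the common step length `min h
      -- (-k)`.
      have hm : 0 < min h (-k) := lt_min hh (neg_pos.2 hk)
      calc erealSlope f U s h ≤ erealSlope f U s (min h (-k)) :=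
            hf.erealSlope_le_of_pos hs hm (min_le_left _ _)
        _ ≤ erealSlope g W r (-min h (-k)) := erealSlope_le_of_add_le H hm
        _ ≤ erealSlope g W r k := hg.erealSlope_le_of_neg hr (neg_lt_zero.2 hm)
            (by linarith [min_le_right h (-k)])
    exact ⟨aux hf hg hs hr H, aux hg hf hr hs H'⟩
  · rintro ⟨h₁, h₂⟩ h
    rcases lt_trichotomy h 0 with hh | rfl | hh
    · have hh' : 0 < -h := neg_pos.2 hh
      have := add_le_of_erealSlope_le (f := g) (g := f) hg0 hh' (((erealSlope_le_rightSlope hh').trans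
        h₂).trans (leftSlope_le_erealSlope (neg_lt_zero.2 hh')))
      rwa [sub_neg_eq_add, ← sub_eq_add_neg, add_comm, add_comm r s] at this
    · rw [add_zero, sub_zero, hs, hr, ← EReal.coe_add]
    · exact add_le_of_erealSlope_le hf0 hh (((erealSlope_le_rightSlope hh).trans
        h₁).trans (leftSlope_le_erealSlope (neg_lt_zero.2 hh)))

theorem coe_add_le_of_add_le {a r : ℝ} {x y : EReal} (hx : (a : EReal) ≤ x) (hy : y = (r : EReal))
    {z : EReal} (hz : x + y ≤ z) : ((a + r : ℝ) : EReal) ≤ z := by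
  rw [EReal.coe_add, ← hy]
  exact (add_le_add_left hx y).trans hz

/-- The competitor for `k` at `U + W + h` moves only the first argument and keeps the second at `W`.
-/
theorem erealSlope_le_of_le_add (hk : ∀ x y, f x + g y ≤ k (x + y)) (hr : g W = r) {h : ℝ}
    (hh : 0 < h) : erealSlope f U s h ≤ erealSlope k (U + W) (s + r) h := by
  rw [← EReal.ge_of_forall_gt_iff_ge]
  intro b hb
  rw [le_erealSlope_of_pos hh]
  have h1 := coe_add_le_of_add_le ((le_erealSlope_of_pos hh).1 hb.le) hr (hk (U + h) W)
  rwa [add_right_comm, add_right_comm U] at h1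

theorem le_erealSlope_of_le_add (hk : ∀ x y, f x + g y ≤ k (x + y)) (hr : g W = r) {h : ℝ}
    (hh : h < 0) : erealSlope k (U + W) (s + r) h ≤ erealSlope f U s h := by
  rw [← EReal.le_of_forall_lt_iff_le]
  intro b hb
  rw [erealSlope_le_of_neg hh]
  have h1 := coe_add_le_of_add_le ((erealSlope_le_of_neg hh).1 hb.le) hr (hk (U + h) W)
  rwa [add_right_comm, add_right_comm U] at h1

/-- The one sided derivatives of a sup-convolution at a point where it is attained. -/
theorem slopes_supConvolution (hkc : HypographConvex k)
    (hle : ∀ x y, f x + g y ≤ k (x + y))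
    (hge : ∀ (x a : ℝ), (a : EReal) < k x → ∃ y z : ℝ, y + z = x ∧ (a : EReal) ≤ f y + g z)
    (hf : HypographConvex f) (hg : HypographConvex g)
    (hs : f U = s) (hr : g W = r) (hks : k (U + W) = ((s + r : ℝ) : EReal))
    (hfp : 0 < rightSlope f U s) (h₁ : rightSlope f U s ≤ leftSlope g W r)
    (h₂ : rightSlope g W r ≤ leftSlope f U s) :
    rightSlope k (U + W) (s + r) = max (rightSlope f U s) (rightSlope g W r) ∧
      leftSlope k (U + W) (s + r) = min (leftSlope f U s) (leftSlope g W r) := by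
  have hle' : ∀ x y, g x + f y ≤ k (x + y) := fun x y => by
    rw [add_comm, add_comm x y]; exact hle y x
  have hR : max (rightSlope f U s) (rightSlope g W r) ≤ rightSlope k (U + W) (s + r) := by
    refine max_le (rightSlope_le_iff.2 fun h hh => ?_) (rightSlope_le_iff.2 fun h hh => ?_)
    · exact (erealSlope_le_of_le_add hle hr hh).trans (erealSlope_le_rightSlope hh)
    · have := erealSlope_le_of_le_add (U := W) (s := r) hle' hs hh
      rw [add_comm W, add_comm r] at this
      exact this.trans (erealSlope_le_rightSlope hh)
  have hL : leftSlope k (U + W) (s + r) ≤ min (leftSlope f U s) (leftSlope g W r) := by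
    refine le_min (le_leftSlope_iff.2 fun h hh => ?_) (le_leftSlope_iff.2 fun h hh => ?_)
    · exact (leftSlope_le_erealSlope hh).trans (le_erealSlope_of_le_add hle hr hh)
    · have := le_erealSlope_of_le_add (U := W) (s := r) hle' hs hh
      rw [add_comm W, add_comm r] at this
      exact (leftSlope_le_erealSlope hh).trans this
  have hmm : max (rightSlope f U s) (rightSlope g W r) ≤
      min (leftSlope f U s) (leftSlope g W r) :=
    le_min (max_le (hf.rightSlope_le_leftSlope hs) h₂) (max_le h₁ (hg.rightSlope_le_leftSlope hr))
  -- A common supergradient `b` of `f` at `U` and of `g` at `W` is a supergradient of `k`, since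
  -- every decomposition `y + z` is bounded by the sum of the two affine majorants.
  have hsup : ∀ b : ℝ, max (rightSlope f U s) (rightSlope g W r) ≤ b →
      b ≤ min (leftSlope f U s) (leftSlope g W r) → ∀ h : ℝ,
      k (U + W + h) ≤ ((s + r + b * h : ℝ) : EReal) := by
    intro b hb₁ hb₂ h
    rw [← EReal.ge_of_forall_gt_iff_ge]
    intro a ha
    obtain ⟨y, z, hyz, hayz⟩ := hge _ _ ha
    have e₁ := le_of_rightSlope_le_of_le_leftSlope hs ((le_max_left _ _).trans hb₁)
      (hb₂.trans (min_le_left _ _)) (y - U)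
    have e₂ := le_of_rightSlope_le_of_le_leftSlope hr ((le_max_right _ _).trans hb₁)
      (hb₂.trans (min_le_right _ _)) (z - W)
    rw [add_sub_cancel] at e₁ e₂
    refine (hayz.trans (add_le_add e₁ e₂)).trans ?_
    rw [← EReal.coe_add, EReal.coe_le_coe_iff]
    have : h = y - U + (z - W) := by linarith
    rw [this]; linarith
  have hkRL := hkc.rightSlope_le_leftSlope hks
  -- If the maximum is `⊤`, no real supergradient exists, but both one-sided derivatives of `k` and
  -- the minimum are then `⊤`.
  by_cases htop : max (rightSlope f U s) (rightSlope g W r) = ⊤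
  · rw [htop, top_le_iff] at hmm hR
    rw [hR, top_le_iff] at hkRL
    exact ⟨by rw [hR, htop], by rw [hkRL, hmm]⟩
  · have hbot : max (rightSlope f U s) (rightSlope g W r) ≠ ⊥ :=
      (lt_of_lt_of_le (lt_of_le_of_lt bot_le hfp) (le_max_left _ _)).ne'
    set M := (max (rightSlope f U s) (rightSlope g W r)).toReal with hM
    have hMe : (M : EReal) = max (rightSlope f U s) (rightSlope g W r) :=
      EReal.coe_toReal htop hbot
    refine ⟨le_antisymm ?_ hR, le_antisymm hL ?_⟩
    · rw [← hMe]
      exact rightSlope_le_iff.2 fun h hh =>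
        (erealSlope_le_of_pos hh).2 (hsup M hMe.ge (hMe ▸ hmm) h)
    · rw [← EReal.ge_of_forall_gt_iff_ge]
      intro z hz
      -- The number `z` may lie below the right derivatives; `max z M` is a genuine common
      -- supergradient that dominates it.
      have hb : ((max z M : ℝ) : EReal) ≤ min (leftSlope f U s) (leftSlope g W r) := by
        rcases max_cases z M with ⟨h, -⟩ | ⟨h, -⟩ <;> rw [h]
        · exact hz.le
        · rw [hMe]; exact hmm
      refine le_leftSlope_iff.2 fun h hh => (le_trans ?_ ((le_erealSlope_of_neg hh).2
        (hsup (max z M) (hMe.ge.trans (EReal.coe_le_coe_iff.2 (le_max_right _ _))) hb h)))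
      exact EReal.coe_le_coe_iff.2 (le_max_left _ _)

end SupConvolution

/-- Positivity is essential: inversion sends `⊥`, `0` and `⊤` all to `0`. -/
theorem EReal.inv_le_inv_iff_of_pos {x y : EReal} (hx : 0 < x) (hy : 0 < y) :
    x⁻¹ ≤ y⁻¹ ↔ y ≤ x :=
  EReal.inv_strictAntiOn.le_iff_ge hx hy

/-! ### Temperature intervals and the main theorem. -/

namespace HamiltonianTriple

variable {V : Type*} [NormedAddCommGroup V] [NormedSpace ℝ V] [MeasurableSpace V] [BorelSpace V]
  {H : HamiltonianTriple V}

theorem IsTame.hypographConvex (h : H.IsTame) : HypographConvex H.eqEntropy :=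
  hypographConvex_of_lt fun _ _ _ _ _ ht0 ht1 hs hr => h.eqEntropy_concave ht0 ht1 hs hr

/-- Concavity makes the difference quotients monotone, so the limits defining the two derivatives
exist and `limUnder` returns them. -/
theorem IsTame.tempInterval_eq (h : H.IsTame) {U s : ℝ} (hs : H.eqEntropy U = s) :
    H.tempInterval U = Icc (leftSlope H.eqEntropy U s)⁻¹ (rightSlope H.eqEntropy U s)⁻¹ := by
  have e₁ : H.betaLeft U = leftSlope H.eqEntropy U s := by
    unfold betaLeft
    rw [hs]
    exact (h.hypographConvex.tendsto_leftSlope hs).limUnder_eq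
  have e₂ : H.betaRight U = rightSlope H.eqEntropy U s := by
    unfold betaRight
    rw [hs]
    exact (h.hypographConvex.tendsto_rightSlope hs).limUnder_eq
  rw [tempInterval, e₁, e₂]

end HamiltonianTriple

theorem mainTheorem10
    {V₁ V₂ : Type*}
    [NormedAddCommGroup V₁] [NormedSpace ℝ V₁] [FiniteDimensional ℝ V₁]
    [MeasurableSpace V₁] [BorelSpace V₁]
    [NormedAddCommGroup V₂] [NormedSpace ℝ V₂] [FiniteDimensional ℝ V₂]
    [MeasurableSpace V₂] [BorelSpace V₂]
    (H₁ : HamiltonianTriple V₁) (H₂ : HamiltonianTriple V₂)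
    (h₁ : H₁.IsSystem) (h₂ : H₂.IsSystem)
    (hK₁ : H₁.KUnstable) (hK₂ : H₂.KUnstable)
    (U₁ U₂ : ℝ) (hU₁ : U₁ ∈ H₁.energyInterval) (hU₂ : U₂ ∈ H₂.energyInterval)
    (u₁ : V₁ → ENNReal) (u₂ : V₂ → ENNReal)
    (hu₁ : H₁.IsEquilibrium U₁ u₁) (hu₂ : H₂.IsEquilibrium U₂ u₂) :
    (HamiltonianTriple.Isothermal H₁ H₂ u₁ u₂ ↔
      (H₁.tempInterval U₁ ∩ H₂.tempInterval U₂).Nonempty) ∧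
    (HamiltonianTriple.Isothermal H₁ H₂ u₁ u₂ →
      (H₁.composite H₂).tempInterval (U₁ + U₂) =
        H₁.tempInterval U₁ ∩ H₂.tempInterval U₂) := by
  have : ProperSpace V₁ := FiniteDimensional.proper ℝ V₁
  have : ProperSpace V₂ := FiniteDimensional.proper ℝ V₂
  have t₁ := h₁.isTame
  have t₂ := h₂.isTame
  have t := t₁.composite t₂
  have hfin₁ := fun u (hu : H₁.IsState u) => h₁.klInt_ne_top hu
  have hfin₂ := fun u (hu : H₂.IsState u) => h₂.klInt_ne_top hu
  have hk₁ := hfin₁ u₁ hu₁.1.1 (by rw [hu₁.1.2]; exact EReal.coe_ne_top _)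
  have hk₂ := hfin₂ u₂ hu₂.1.1 (by rw [hu₂.1.2]; exact EReal.coe_ne_top _)
  obtain ⟨e₁, ⟨s, hs0, hs⟩, E₁, hUE₁, hE₁⟩ := t₁.eqEntropy_of_isEquilibrium hfin₁ hU₁ hu₁
  obtain ⟨e₂, ⟨r, hr0, hr⟩, E₂, hUE₂, hE₂⟩ := t₂.eqEntropy_of_isEquilibrium hfin₂ hU₂ hu₂
  have fs : H₁.eqEntropy U₁ = s := e₁.trans hs
  have fr : H₂.eqEntropy U₂ = r := e₂.trans hr
  have c₁ := t₁.hypographConvex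
  have c₂ := t₂.hypographConvex
  have hpS := HamiltonianTriple.isState_prodState t₁ t₂ hu₁.1.1 hu₂.1.1
  have hpE := HamiltonianTriple.energy_prodState t₁ t₂ hu₁.1.1 hu₂.1.1 hu₁.1.2 hu₂.1.2
  have hpK : (H₁.composite H₂).entropy (HamiltonianTriple.prodState u₁ u₂) =
      ((s + r : ℝ) : EReal) := by
    rw [HamiltonianTriple.entropy_prodState t₁ t₂ hu₁.1.1 hu₂.1.1 hk₁ hk₂, hs, hr, EReal.coe_add]
  have hge : ((s + r : ℝ) : EReal) ≤ (H₁.composite H₂).eqEntropy (U₁ + U₂) :=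
    hpK ▸ HamiltonianTriple.entropy_le_eqEntropy hpS hpE
  have hconv := HamiltonianTriple.eqEntropy_add_le t₁ t₂
  have hiso₀ : HamiltonianTriple.Isothermal H₁ H₂ u₁ u₂ ↔
      (H₁.composite H₂).eqEntropy (U₁ + U₂) ≤ ((s + r : ℝ) : EReal) := by
    unfold HamiltonianTriple.Isothermal HamiltonianTriple.IsEquilibrium
    rw [hu₁.1.2, hu₂.1.2, ← EReal.coe_add, hpK]
    constructor
    · rintro ⟨-, H⟩
      refine sSup_le ?_
      rintro _ ⟨v, hv, rfl⟩
      exact H v hv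
    · exact fun H => ⟨⟨hpS, hpE⟩, fun v hv =>
        (HamiltonianTriple.entropy_le_eqEntropy hv.1 hv.2).trans H⟩
  have hiso₁ : (H₁.composite H₂).eqEntropy (U₁ + U₂) ≤ ((s + r : ℝ) : EReal) ↔
      ∀ h : ℝ, H₁.eqEntropy (U₁ + h) + H₂.eqEntropy (U₂ - h) ≤ ((s + r : ℝ) : EReal) := by
    constructor
    · intro H h
      have := hconv (U₁ + h) (U₂ - h)
      rw [add_add_sub_cancel] at this
      exact this.trans H
    · intro H
      refine sSup_le ?_
      rintro _ ⟨v, hv, rfl⟩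
      obtain ⟨y, z, hyz, hle⟩ :=
        HamiltonianTriple.exists_entropy_le_add t₁ t₂ hfin₁ hfin₂ hv.1 hv.2
      have h' := H (y - U₁)
      have e : U₂ - (y - U₁) = z := by linarith
      rw [add_sub_cancel, e] at h'
      exact hle.trans h'
  have hiso := (hiso₀.trans hiso₁).trans (forall_add_le_iff c₁ c₂ t₁.eqEntropy_nonpos
    t₂.eqEntropy_nonpos fs fr)
  have p₁ := rightSlope_pos hUE₁ hE₁ hs0
  have p₂ := rightSlope_pos hUE₂ hE₂ hr0
  have l₁ := c₁.rightSlope_le_leftSlope fs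
  have l₂ := c₂.rightSlope_le_leftSlope fr
  have q₁ := p₁.trans_le l₁
  have q₂ := p₂.trans_le l₂
  constructor
  -- The intersection is non-empty exactly when four inequalities between slopes hold. Two of them,
  -- `l₁` and `l₂`, come from concavity; the other two are the isothermality criterion.
  · rw [hiso, t₁.tempInterval_eq fs, t₂.tempInterval_eq fr, Icc_inter_Icc, nonempty_Icc,
      sup_le_iff, le_inf_iff, le_inf_iff, EReal.inv_le_inv_iff_of_pos q₁ p₁,
      EReal.inv_le_inv_iff_of_pos q₁ p₂, EReal.inv_le_inv_iff_of_pos q₂ p₁,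
      EReal.inv_le_inv_iff_of_pos q₂ p₂]
    tauto
  · intro hI
    have hks : (H₁.composite H₂).eqEntropy (U₁ + U₂) = ((s + r : ℝ) : EReal) :=
      le_antisymm (hiso₀.1 hI) hge
    obtain ⟨i₁, i₂⟩ := hiso.1 hI
    obtain ⟨hR, hL⟩ := slopes_supConvolution t.hypographConvex hconv (fun x a ha => by
      obtain ⟨_, ⟨v, hv, rfl⟩, hlt⟩ := lt_sSup_iff.1 ha
      obtain ⟨y, z, hyz, hle⟩ :=
        HamiltonianTriple.exists_entropy_le_add t₁ t₂ hfin₁ hfin₂ hv.1 hv.2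
      exact ⟨y, z, hyz, hlt.le.trans hle⟩) c₁ c₂ fs fr hks p₁ i₁ i₂
    rw [t.tempInterval_eq hks, t₁.tempInterval_eq fs, t₂.tempInterval_eq fr, hR, hL, Icc_inter_Icc]
    -- Inversion reverses order on positive numbers, so the minimum of the left slopes gives the
    -- larger lower end and the maximum of the right slopes the smaller upper end.
    congr 1
    · exact EReal.inv_strictAntiOn.antitoneOn.map_min q₁ q₂
    · exact EReal.inv_strictAntiOn.antitoneOn.map_max p₁ p₂
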